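/- Let $X$ be a compact Hausdorff space. A $C(X)$-algebra is a $C^*$-algebra $A$ (not necessarily unital) together with a unital $*$-homomorphism from $C(X)$ into the centre of the multiplier algebra $M(A)$; write $fa$ for the resulting product of $f\in C(X)$ and $a\in A$. For $x\in X$ let $C_x(X)=\{f\in C(X): f(x)=0\}$, let $A_x$ be the quotient of $A$ by the closed ideal $C_x(X)A$, and let $a_x$ be the image of $a\in A$ in $A_x$. For two $C(X)$-algebras $A$ and $B$, let $A\otimes_{alg}B$ be their algebraic tensor product over $\mathbb{C}$. Let $\mathcal{I}(A,B)$ be the involutive ideal of $A\otimes_{alg}B$ generated by the elements $(fa)\otimes b-a\otimes(fb)$ with $f\in C(X)$, $a\in A$, $b\in B$, and let $\mathcal{J}(A,B)$ be the involutive ideal of all $\alpha\in A\otimes_{alg}B$ whose image $\alpha_x$ in $A_x\otimes_{alg}B_x$ is zero for every $x\in X$. Let $A$ and $B$ be two $C(X)$-algebras and assume that there exists a finite subset $F\subset X$ such that for all $a\in A$ the function $x\mapsto\|a_x\|$ is continuous on $X\setminus F$. Then $\mathcal{I}(A,B)=\mathcal{J}(A,B)$. In particular, if $\mathbb{N}\cup\{\infty\}$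 denotes the one-point (Alexandroff) compactification of the discrete space $\mathbb{N}$, then $\mathcal{I}(A,B)=\mathcal{J}(A,B)$ for any two $C(\mathbb{N}\cup\{\infty\})$-algebras $A$ and $B$. -/

import Mathlib

open scoped TensorProduct

noncomputable section

/-- A `C(X)`-algebra: a (not necessarily unital) C⋆-algebra `A` together with a unital
⋆-homomorphism from `C(X)` to the multiplier algebra `M(A)` whose range lies in the centre. -/
class CXAlgebra (X : Type*) (A : Type*) [TopologicalSpace X] [NonUnitalCStarAlgebra A] where
  /-- The structure morphism `C(X) → M(A)` (a `StarAlgHom`, hence unital). -/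
  toMultiplier : C(X, ℂ) →⋆ₐ[ℂ] DoubleCentralizer ℂ A
  /-- The structure morphism takes values in the centre of `M(A)`. -/
  central : ∀ f : C(X, ℂ), toMultiplier f ∈ Subalgebra.center ℂ (DoubleCentralizer ℂ A)

namespace CXAlgebra

section Fibre

variable {X : Type*} (A : Type*) [TopologicalSpace X] [NonUnitalCStarAlgebra A] [CXAlgebra X A]

variable {A} in
/-- The product `f a ∈ A` of `f ∈ C(X)` and `a ∈ A`, i.e. the multiplier given by `f` applied
to `a` (on the left; the right action agrees with it because `f` acts centrally). -/
def act (f : C(X, ℂ)) (a : A) : A := (toMultiplier (A := A) f).fst a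

/-- The closed ideal `C_x(X) A` of `A`: the closed linear span of the products `f a` with
`f ∈ C(X)`, `f x = 0` and `a ∈ A`. -/
def fibreIdeal (x : X) : Submodule ℂ A :=
  (Submodule.span ℂ {c : A | ∃ (f : C(X, ℂ)) (a : A), f x = 0 ∧ c = act f a}).topologicalClosure

instance (x : X) : IsClosed (fibreIdeal A x : Set A) :=
  Submodule.isClosed_topologicalClosure _

/-- The fibre `A_x = A / C_x(X) A`, with its quotient norm (which is its C⋆-norm). -/
abbrev Fibre (x : X) : Type _ := A ⧸ fibreIdeal A x

/-- The quotient map `A → A_x`, `a ↦ a_x`. -/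
def toFibre (x : X) : A →ₗ[ℂ] Fibre A x := (fibreIdeal A x).mkQ

end Fibre

section Ideals

/-- A linear subspace of the algebraic tensor product `A ⊗ B` over `ℂ` is an involutive ideal if
it is a two-sided ideal that is stable under the involution `(a ⊗ b)⋆ = a⋆ ⊗ b⋆`. -/
structure IsInvolutiveIdeal {A B : Type*} [NonUnitalCStarAlgebra A] [NonUnitalCStarAlgebra B]
    (S : Submodule ℂ (A ⊗[ℂ] B)) : Prop where
  mul_mem_left : ∀ s t : A ⊗[ℂ] B, t ∈ S → s * t ∈ S
  mul_mem_right : ∀ s t : A ⊗[ℂ] B, s ∈ S → s * t ∈ S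
  star_mem : ∀ s : A ⊗[ℂ] B, s ∈ S → star s ∈ S

variable (X A B : Type*) [TopologicalSpace X] [NonUnitalCStarAlgebra A] [NonUnitalCStarAlgebra B]
  [CXAlgebra X A] [CXAlgebra X B]

/-- `I(A, B)`: the involutive ideal of `A ⊗ B` generated by the elements
`(f a) ⊗ b - a ⊗ (f b)`, `f ∈ C(X)`, `a ∈ A`, `b ∈ B`. -/
def idealI : Submodule ℂ (A ⊗[ℂ] B) :=
  sInf {S : Submodule ℂ (A ⊗[ℂ] B) | IsInvolutiveIdeal S ∧
    ∀ (f : C(X, ℂ)) (a : A) (b : B), act f a ⊗ₜ[ℂ] b - a ⊗ₜ[ℂ] act f b ∈ S}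

/-- `J(A, B)`: the set of `α ∈ A ⊗ B` whose image `α_x` in the algebraic tensor product
`A_x ⊗ B_x` over `ℂ` is zero for every `x ∈ X`. -/
def idealJ : Submodule ℂ (A ⊗[ℂ] B) :=
  ⨅ x : X, LinearMap.ker (TensorProduct.map (toFibre A x) (toFibre B x))

end Ideals

end CXAlgebra

end

/-! The inclusion I ⊆ J holds because the kernel of each map A ⊗ B → A_x ⊗ B_x is an involutive
ideal containing the generators of I.

Conversely let α ∈ J. Modulo I one can write α = ∑ aᵢ ⊗ bᵢ with (aᵢ)_x = 0 for all x ∈ F: since α_x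
= 0, the terms not already in C_x(X)A ⊗ B have their right factor in C_x(X)B; by Cohen factorization
it is g c with g x = 0, and g can be moved to the left factor (`leftRange_inf_ker_le`). As fibre
norms are upper semicontinuous, the fibre norms of all combinations of the aᵢ are then continuous on
the whole of X.

The core is `exists_factorization`: aᵢ = ∑ⱼ Tᵢⱼ a'ⱼ with Tᵢⱼ ∈ C(X), where the rows of T at x
satisfy every linear relation between the (aᵢ)_x. So Tᵢⱼ(x) = φ((aᵢ)_x) for a functional φ, and
applying φ ⊗ id to α_x = 0 gives ∑ᵢ Tᵢⱼ bᵢ = 0 in every fibre, hence in B. Then α = ∑ (Tᵢⱼ a'ⱼ ⊗ bᵢ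
- a'ⱼ ⊗ Tᵢⱼ bᵢ) ∈ I.

The relations at x form the kernel of a seminorm varying continuously with x, but its dimension may
jump. Proximal points give continuous vector fields orthogonal to these kernels, which assemble into
a positive matrix G over C(X) with exactly these relations as left kernel (`exists_isPositive_ker`).
The tuple (aᵢ) lies fibrewise in the range of G, and `exists_eq_matrixAct` makes this global, with T
in the closed right ideal generated by G. -/

noncomputable section

namespace CXAlgebra

open Topology

/-! ### Module structure of A over C(X) -/

section Action

variable {X A : Type*} [TopologicalSpace X] [NonUnitalCStarAlgebra A] [CXAlgebra X A]

@[simp] lemma one_act (a : A) : act (1 : C(X, ℂ)) a = a := by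
  simp [act]

lemma mul_act (f g : C(X, ℂ)) (a : A) : act (f * g) a = act f (act g a) := by
  simp [act]

lemma add_act (f g : C(X, ℂ)) (a : A) : act (f + g) a = act f a + act g a := by
  simp [act]

lemma sub_act (f g : C(X, ℂ)) (a : A) : act (f - g) a = act f a - act g a := by
  simp [act]

lemma smul_act (c : ℂ) (f : C(X, ℂ)) (a : A) : act (c • f) a = c • act f a := by
  simp [act]

@[simp] lemma zero_act (a : A) : act (0 : C(X, ℂ)) a = 0 := by
  simp [act]

lemma act_add (f : C(X, ℂ)) (a b : A) : act f (a + b) = act f a + act f b := by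
  simp [act]

lemma act_smul (c : ℂ) (f : C(X, ℂ)) (a : A) : act f (c • a) = c • act f a := by
  simp [act]

@[simp] lemma act_zero (f : C(X, ℂ)) : act f (0 : A) = 0 := by
  simp [act]

variable (X A) in
/-- The action of `C(X)` on `A` as a bilinear map. -/
def actHom : C(X, ℂ) →ₗ[ℂ] A →ₗ[ℂ] A :=
  LinearMap.mk₂ ℂ act add_act smul_act act_add (fun c f a => act_smul c f a)

lemma actHom_apply (f : C(X, ℂ)) (a : A) : actHom X A f a = act f a := rfl

lemma act_sum {ι : Type*} (s : Finset ι) (f : C(X, ℂ)) (a : ι → A) :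
    act f (∑ i ∈ s, a i) = ∑ i ∈ s, act f (a i) :=
  map_sum (actHom X A f) a s

lemma sum_act {ι : Type*} (s : Finset ι) (f : ι → C(X, ℂ)) (a : A) :
    act (∑ i ∈ s, f i) a = ∑ i ∈ s, act (f i) a := by
  simp only [← actHom_apply, map_sum, LinearMap.sum_apply]

lemma act_const (c : ℂ) (a : A) : act (ContinuousMap.const X c) a = c • a := by
  have : (ContinuousMap.const X c) = c • (1 : C(X, ℂ)) := by ext; simp
  rw [this, smul_act, one_act]

lemma eq_of_forall_mul_right_eq {x y : A} (h : ∀ z, x * z = y * z) : x = y := by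
  have := h (star (x - y))
  rw [← sub_eq_zero, ← sub_mul, CStarRing.mul_star_self_eq_zero_iff, sub_eq_zero] at this
  exact this

lemma mul_act_eq (f : C(X, ℂ)) (a b : A) : a * act f b = act f (a * b) := by
  have h := (Subalgebra.mem_center_iff.mp (central (A := A) f)) (a : DoubleCentralizer ℂ A)
  have h' := congr(($h).fst b)
  simpa [act] using h'

/-- The double centralizer identity gives equality after left multiplication by any z; taking
adjoints allows z to be cancelled. -/
lemma act_mul_eq (f : C(X, ℂ)) (a b : A) : act f a * b = act f (a * b) := by
  have key (z : A) : z * (act f a * b) = z * act f (a * b) := by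
    have h₁ := (toMultiplier (A := A) f).central z a
    have h₂ := (toMultiplier (A := A) f).central z (a * b)
    rw [act, act, ← h₂, ← mul_assoc, ← h₁, mul_assoc]
  have := fun z => congrArg star (key (star z))
  simp only [star_mul, star_star] at this
  exact star_injective (eq_of_forall_mul_right_eq fun z => by simpa using this z)

lemma snd_toMultiplier (f : C(X, ℂ)) (a : A) :
    (toMultiplier (A := A) f).snd a = act f a :=
  eq_of_forall_mul_right_eq fun z => by
    rw [(toMultiplier (A := A) f).central a z, act_mul_eq, ← mul_act_eq, act]

lemma star_act (f : C(X, ℂ)) (a : A) : star (act f a) = act (star f) (star a) := by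
  have h : toMultiplier (A := A) (star f) = star (toMultiplier (A := A) f) :=
    map_star (toMultiplier (A := A)) f
  rw [← snd_toMultiplier (star f), h, DoubleCentralizer.star_snd, star_star, act]

lemma norm_act_le [CompactSpace X] (f : C(X, ℂ)) (a : A) : ‖act f a‖ ≤ ‖f‖ * ‖a‖ := by
  refine ((toMultiplier (A := A) f).fst.le_opNorm a).trans ?_
  rw [DoubleCentralizer.norm_fst]
  gcongr
  exact NonUnitalStarAlgHom.norm_apply_le (toMultiplier (A := A)) f

end Action
end CXAlgebra
end

noncomputable section

namespace CXAlgebra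

open Topology

/-! ### Fibre ideals and fibre maps -/

section FibreIdeal

variable {X A : Type*} [TopologicalSpace X] [NonUnitalCStarAlgebra A] [CXAlgebra X A]

lemma act_mem_fibreIdeal {x : X} {f : C(X, ℂ)} (hf : f x = 0) (a : A) :
    act f a ∈ fibreIdeal A x :=
  Submodule.le_topologicalClosure _ (Submodule.subset_span ⟨f, a, hf, rfl⟩)

/-- A continuous additive map preserving the generators of the fibre ideal preserves it. -/
lemma map_mem_fibreIdeal {x : X} (φ : A →+ A) (hφ : Continuous φ)
    (h : ∀ (f : C(X, ℂ)) (a : A), f x = 0 → φ (act f a) ∈ fibreIdeal A x) {a : A}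
    (ha : a ∈ fibreIdeal A x) : φ a ∈ fibreIdeal A x := by
  have hs : Submodule.span ℂ {c : A | ∃ (f : C(X, ℂ)) (a : A), f x = 0 ∧ c = act f a} ≤
      (fibreIdeal A x) := Submodule.le_topologicalClosure _
  refine closure_minimal (t := φ ⁻¹' (fibreIdeal A x : Set A)) ?_
    ((inferInstance : IsClosed (fibreIdeal A x : Set A)).preimage hφ) ha
  intro b hb
  refine Submodule.closure_induction (p := fun b _ => φ b ∈ fibreIdeal A x) ?_ ?_ ?_ hb
  · simp
  · intro b c _ _ hb hc
    rw [map_add]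
    exact add_mem hb hc
  -- The scalar is absorbed into the algebra element, so φ need only be additive; this covers the
  -- conjugate-linear star.
  · rintro r _ ⟨f, a, hf, rfl⟩
    rw [← act_smul]
    exact h f _ hf

lemma continuous_act (f : C(X, ℂ)) : Continuous (act f : A → A) :=
  ((toMultiplier (A := A) f).fst).continuous

lemma act_mem_fibreIdeal_of_mem {x : X} (f : C(X, ℂ)) {a : A} (ha : a ∈ fibreIdeal A x) :
    act f a ∈ fibreIdeal A x :=
  map_mem_fibreIdeal (actHom X A f).toAddMonoidHom (continuous_act f)
    (fun g b hg => by
      change act f (act g b) ∈ _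
      rw [← mul_act]
      exact act_mem_fibreIdeal (by simp [hg]) b) ha

lemma mul_mem_fibreIdeal_left {x : X} (b : A) {a : A} (ha : a ∈ fibreIdeal A x) :
    b * a ∈ fibreIdeal A x :=
  map_mem_fibreIdeal (AddMonoidHom.mulLeft b) (continuous_const_mul b)
    (fun f a hf => by
      simpa [mul_act_eq] using act_mem_fibreIdeal hf (b * a)) ha

lemma mul_mem_fibreIdeal_right {x : X} (b : A) {a : A} (ha : a ∈ fibreIdeal A x) :
    a * b ∈ fibreIdeal A x :=
  map_mem_fibreIdeal (AddMonoidHom.mulRight b) (continuous_mul_const b)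
    (fun f a hf => by
      simpa [act_mul_eq] using act_mem_fibreIdeal hf (a * b)) ha

lemma star_mem_fibreIdeal {x : X} {a : A} (ha : a ∈ fibreIdeal A x) :
    star a ∈ fibreIdeal A x :=
  map_mem_fibreIdeal (starAddEquiv : A ≃+ A).toAddMonoidHom continuous_star
    (fun f a hf => by
      simpa [star_act] using act_mem_fibreIdeal (f := star f) (by simp [hf]) (star a)) ha

@[simp] lemma toFibre_eq_zero_iff {x : X} {a : A} : toFibre A x a = 0 ↔ a ∈ fibreIdeal A x :=
  Submodule.Quotient.mk_eq_zero _

lemma toFibre_surjective (x : X) : Function.Surjective (toFibre A x) :=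
  Submodule.mkQ_surjective _

lemma ker_toFibre (x : X) : LinearMap.ker (toFibre A x) = fibreIdeal A x :=
  Submodule.ker_mkQ _

lemma toFibre_act (x : X) (f : C(X, ℂ)) (a : A) :
    toFibre A x (act f a) = f x • toFibre A x a := by
  rw [← sub_eq_zero, ← map_smul, ← map_sub, toFibre_eq_zero_iff, ← act_const (X := X), ← sub_act]
  exact act_mem_fibreIdeal (by simp) a

lemma norm_toFibre_le (x : X) (a : A) : ‖toFibre A x a‖ ≤ ‖a‖ :=
  Submodule.Quotient.norm_mk_le _ a

end FibreIdeal

/-! ### Fibre norms: upper semicontinuity and control of the global norm -/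

section Localization

variable {X A : Type*} [TopologicalSpace X]

/-- A continuous real function regarded as a complex function. -/
def ofRealMap (ψ : C(X, ℝ)) : C(X, ℂ) := ⟨fun x => (ψ x : ℂ), by fun_prop⟩

@[simp] lemma ofRealMap_apply (ψ : C(X, ℝ)) (x : X) : ofRealMap ψ x = (ψ x : ℂ) := rfl

variable [CompactSpace X]

lemma norm_ofRealMap_le {ψ : C(X, ℝ)} (h : ∀ y, ψ y ∈ Set.Icc 0 1) : ‖ofRealMap ψ‖ ≤ 1 := by
  rw [ContinuousMap.norm_le _ zero_le_one]
  intro x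
  simpa [abs_of_nonneg (h x).1] using (h x).2

lemma norm_act_ofRealMap_le [NonUnitalCStarAlgebra A] [CXAlgebra X A] {ψ : C(X, ℝ)}
    (h : ∀ y, ψ y ∈ Set.Icc 0 1) (a : A) : ‖act (ofRealMap ψ) a‖ ≤ ‖a‖ :=
  (norm_act_le _ a).trans (mul_le_of_le_one_left (norm_nonneg a) (norm_ofRealMap_le h))

variable [T2Space X]

lemma exists_bump {x : X} {U : Set X} (hU : U ∈ 𝓝 x) :
    ∃ ψ : C(X, ℝ), (∀ y, ψ y ∈ Set.Icc 0 1) ∧ (∀ y ∉ U, ψ y = 0) ∧ ∀ᶠ y in 𝓝 x, ψ y = 1 := by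
  obtain ⟨V, hV, hVc, hVU⟩ := exists_mem_nhds_isClosed_subset (interior_mem_nhds.mpr hU)
  obtain ⟨ψ, h0, h1, h⟩ := exists_continuous_zero_one_of_isClosed
    (isClosed_compl_iff.mpr (isOpen_interior (s := U))) hVc
    (Set.disjoint_left.mpr fun y hy hy' => hy (hVU hy'))
  exact ⟨ψ, h, fun y hy => h0 fun hy' => hy (interior_subset hy'),
    Filter.mem_of_superset hV fun y hy => h1 hy⟩

variable [NonUnitalCStarAlgebra A] [CXAlgebra X A]

omit [T2Space X] in
lemma exists_nhds_norm_act_lt_of_mem_fibreIdeal {x : X} {a : A} (ha : a ∈ fibreIdeal A x) {ε : ℝ}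
    (hε : 0 < ε) :
    ∃ U ∈ 𝓝 x, ∀ ψ : C(X, ℝ), (∀ y, ψ y ∈ Set.Icc 0 1) → (∀ y ∉ U, ψ y = 0) →
      ‖act (ofRealMap ψ) a‖ < ε := by
  obtain ⟨b, hb, hab⟩ := Metric.mem_closure_iff.mp ha (ε / 2) (half_pos hε)
  suffices hs : ∀ η > 0, ∃ U ∈ 𝓝 x, ∀ ψ : C(X, ℝ), (∀ y, ψ y ∈ Set.Icc 0 1) →
      (∀ y ∉ U, ψ y = 0) → ‖act (ofRealMap ψ) b‖ < η by
    obtain ⟨U, hU, h⟩ := hs (ε / 2) (half_pos hε)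
    refine ⟨U, hU, fun ψ h01 h0 => ?_⟩
    have e : act (ofRealMap ψ) a = act (ofRealMap ψ) (a - b) + act (ofRealMap ψ) b := by
      rw [← act_add, sub_add_cancel]
    have h₁ := h ψ h01 h0
    have h₂ := norm_act_ofRealMap_le h01 (a - b)
    rw [dist_eq_norm] at hab
    rw [e]
    exact (norm_add_le _ _).trans_lt (by linarith)
  clear hab
  refine Submodule.closure_induction (p := fun b _ => ∀ η > 0, ∃ U ∈ 𝓝 x, ∀ ψ : C(X, ℝ),
    (∀ y, ψ y ∈ Set.Icc 0 1) → (∀ y ∉ U, ψ y = 0) → ‖act (ofRealMap ψ) b‖ < η) ?_ ?_ ?_ hb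
  · exact fun η hη => ⟨Set.univ, Filter.univ_mem, fun ψ _ _ => by simpa using hη⟩
  · intro b c _ _ hb hc η hη
    obtain ⟨U, hU, hb⟩ := hb (η / 2) (half_pos hη)
    obtain ⟨V, hV, hc⟩ := hc (η / 2) (half_pos hη)
    refine ⟨U ∩ V, Filter.inter_mem hU hV, fun ψ h01 h0 => ?_⟩
    have h₁ := hb ψ h01 fun y hy => h0 y fun h => hy h.1
    have h₂ := hc ψ h01 fun y hy => h0 y fun h => hy h.2
    rw [act_add]
    exact (norm_add_le _ _).trans_lt (by linarith)
  · rintro r _ ⟨f, c, hf, rfl⟩ η hη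
    set κ : ℝ := η / 2 / (‖r • c‖ + 1) with hκ
    have hκ0 : 0 < κ := by positivity
    refine ⟨{y | ‖f y‖ < κ}, ?_, fun ψ h01 h0 => ?_⟩
    · exact f.continuous.norm.continuousAt.eventually_lt_const (by simpa [hf] using hκ0)
    · rw [← act_smul, ← mul_act]
      refine (norm_act_le _ _).trans_lt ?_
      have : ‖ofRealMap ψ * f‖ ≤ κ := by
        rw [ContinuousMap.norm_le _ hκ0.le]
        intro y
        by_cases hy : ‖f y‖ < κ
        · have h₁ : ‖(ψ y : ℂ)‖ ≤ 1 := by simpa [abs_of_nonneg (h01 y).1] using (h01 y).2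
          simpa using mul_le_mul h₁ hy.le (norm_nonneg _) zero_le_one
        · simpa [h0 y hy] using hκ0.le
      calc ‖ofRealMap ψ * f‖ * ‖r • c‖ ≤ κ * (‖r • c‖ + 1) := by gcongr; simp
        _ = η / 2 := by rw [hκ]; field_simp
        _ < η := half_lt_self hη

/-- The element differs from a near-optimal lift of its class at x by a member of the fibre ideal,
which a bump with small enough support makes small. This yields upper semicontinuity of the fibre
norm. -/
lemma exists_bump_norm_act_lt {x : X} {a : A} {ε : ℝ} (ha : ‖toFibre A x a‖ < ε) :
    ∃ ψ : C(X, ℝ), (∀ y, ψ y ∈ Set.Icc 0 1) ∧ (∀ᶠ y in 𝓝 x, ψ y = 1) ∧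
      ‖act (ofRealMap ψ) a‖ < ε := by
  obtain ⟨δ, hδ, hδε⟩ := exists_between ha
  obtain ⟨b, hb, hbε⟩ := Submodule.Quotient.norm_mk_lt (toFibre A x a) (sub_pos.mpr hδ)
  have hab : a - b ∈ fibreIdeal A x := by
    rw [← toFibre_eq_zero_iff, map_sub, sub_eq_zero]
    exact hb.symm
  obtain ⟨U, hU, h⟩ := exists_nhds_norm_act_lt_of_mem_fibreIdeal hab (sub_pos.mpr hδε)
  obtain ⟨ψ, h01, h0, h1⟩ := exists_bump hU
  refine ⟨ψ, h01, h1, ?_⟩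
  have e : act (ofRealMap ψ) a = act (ofRealMap ψ) (a - b) + act (ofRealMap ψ) b := by
    rw [← act_add, sub_add_cancel]
  have h₁ := h ψ h01 h0
  have h₂ := norm_act_ofRealMap_le h01 b
  rw [e]
  exact (norm_add_le _ _).trans_lt (by linarith)

lemma eventually_norm_toFibre_lt {x : X} {a : A} {ε : ℝ} (ha : ‖toFibre A x a‖ < ε) :
    ∀ᶠ y in 𝓝 x, ‖toFibre A y a‖ < ε := by
  obtain ⟨ψ, -, h1, h⟩ := exists_bump_norm_act_lt ha
  filter_upwards [h1] with y hy
  calc ‖toFibre A y a‖ = ‖toFibre A y (act (ofRealMap ψ) a)‖ := by simp [toFibre_act, hy]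
    _ ≤ _ := norm_toFibre_le _ _
    _ < ε := h

/-- The iterated squares `a, a², a⁴, …`. -/
def iterSq (a : A) : ℕ → A
  | 0 => a
  | j + 1 => iterSq a j * iterSq a j

omit [TopologicalSpace X] [CompactSpace X] [T2Space X] [CXAlgebra X A] in
lemma norm_iterSq_le (a : A) (j : ℕ) : ‖iterSq a j‖ ≤ ‖a‖ ^ 2 ^ j := by
  induction j with
  | zero => simp [iterSq]
  | succ j ih =>
    rw [iterSq, pow_succ, pow_mul, sq]
    exact (norm_mul_le _ _).trans (by gcongr)

omit [TopologicalSpace X] [CompactSpace X] [T2Space X] [CXAlgebra X A] in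
lemma isSelfAdjoint_iterSq {a : A} (ha : IsSelfAdjoint a) (j : ℕ) : IsSelfAdjoint (iterSq a j) := by
  induction j with
  | zero => exact ha
  | succ j ih => simp [iterSq, IsSelfAdjoint, ih.star_eq]

omit [TopologicalSpace X] [CompactSpace X] [T2Space X] [CXAlgebra X A] in
lemma norm_iterSq {a : A} (ha : IsSelfAdjoint a) (j : ℕ) : ‖iterSq a j‖ = ‖a‖ ^ 2 ^ j := by
  induction j with
  | zero => simp [iterSq]
  | succ j ih =>
    have h := (isSelfAdjoint_iterSq ha j)
    rw [iterSq, pow_succ, pow_mul, sq, ← ih, ← CStarRing.norm_star_mul_self, h.star_eq]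

omit [CompactSpace X] [T2Space X] in
lemma iterSq_act (f : C(X, ℂ)) (a : A) (j : ℕ) :
    iterSq (act f a) j = act (f ^ 2 ^ j) (iterSq a j) := by
  induction j with
  | zero => simp [iterSq]
  | succ j ih =>
    rw [iterSq, ih, iterSq, mul_act_eq, act_mul_eq, ← mul_act, pow_succ, pow_mul, sq]

/-- The norm of a `C(X)`-algebra is at most the supremum of the fibre norms. -/
lemma norm_le_of_forall_norm_toFibre_lt {c : A} {ε : ℝ} (hε : 0 < ε)
    (h : ∀ x : X, ‖toFibre A x c‖ < ε) : ‖c‖ ≤ ε := by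
  choose ψ h01 h1 hψ using fun x => exists_bump_norm_act_lt (h x)
  obtain ⟨t, ht⟩ := CompactSpace.elim_nhds_subcover (fun x => interior {y | ψ x y = 1})
    fun x => interior_mem_nhds.mpr (h1 x)
  obtain ⟨φ, hφ⟩ := PartitionOfUnity.exists_isSubordinate (isClosed_univ (X := X))
    (fun x : t => interior {y | ψ x y = 1}) (fun _ => isOpen_interior) (by
      intro y hy
      have := ht.ge hy
      simpa using this)
  -- Each φ is supported where its ψ equals 1, so arbitrary powers of ψ can be inserted for free.
  have hφψ (x : t) (m : ℕ) : ofRealMap (φ x) * ofRealMap (ψ x) ^ m = ofRealMap (φ x) := by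
    ext y
    by_cases hy : y ∈ tsupport (φ x)
    · have : ψ x y = 1 := (interior_subset (hφ x hy) : y ∈ {y | ψ x y = 1})
      simp [this]
    · simp [image_eq_zero_of_notMem_tsupport hy]
  have hφ1 : ∑ x : t, ofRealMap (φ x) = 1 := by
    ext y
    have := φ.sum_eq_one (Set.mem_univ y)
    rw [finsum_eq_sum_of_fintype] at this
    simp only [ContinuousMap.sum_apply, ofRealMap_apply, ContinuousMap.one_apply]
    exact_mod_cast this
  have hsa : IsSelfAdjoint (star c * c) := .star_mul_self c
  -- The partition of unity costs a factor `t.card`; it is independent of j, so high powers of the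
  -- self-adjoint element c⋆c make it harmless.
  have key (j : ℕ) : (‖c‖ * ‖c‖) ^ 2 ^ j ≤ t.card * (‖c‖ * ε) ^ 2 ^ j := by
    rw [← CStarRing.norm_star_mul_self, ← norm_iterSq hsa, ← one_act (X := X) (iterSq _ j), ← hφ1,
      sum_act]
    calc _ ≤ ∑ x : t, ‖act (ofRealMap (φ x)) (iterSq (star c * c) j)‖ := norm_sum_le _ _
      _ ≤ ∑ x : t, (‖c‖ * ε) ^ 2 ^ j := by
        gcongr with x
        rw [← hφψ x (2 ^ j), mul_act, ← iterSq_act]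
        refine (norm_act_ofRealMap_le (fun y => ⟨φ.nonneg x y, φ.le_one x y⟩) _).trans
          ((norm_iterSq_le _ j).trans ?_)
        gcongr
        rw [← mul_act_eq]
        exact (norm_mul_le _ _).trans (by rw [norm_star]; gcongr; exact (hψ x).le)
      _ = _ := by simp
  by_contra! hc
  have hc0 : 0 < ‖c‖ := hε.trans hc
  have hr : 1 < ‖c‖ / ε := (one_lt_div hε).mpr hc
  obtain ⟨m, hm⟩ := pow_unbounded_of_one_lt (t.card : ℝ) hr
  have h₁ : (‖c‖ / ε) ^ m ≤ (‖c‖ / ε) ^ 2 ^ m :=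
    pow_le_pow_right₀ hr.le Nat.lt_two_pow_self.le
  have h₂ := key m
  rw [mul_pow, mul_pow, mul_left_comm, mul_le_mul_iff_right₀ (by positivity)] at h₂
  rw [div_pow, div_pow] at h₁
  rw [div_pow] at hm
  have h₃ := hm.trans_le h₁
  rw [lt_div_iff₀ (by positivity)] at h₃
  linarith

lemma eq_zero_of_forall_toFibre_eq_zero {c : A} (h : ∀ x : X, toFibre A x c = 0) : c = 0 := by
  rw [← norm_le_zero_iff]
  refine le_of_forall_pos_le_add fun ε hε => ?_
  rw [zero_add]
  exact norm_le_of_forall_norm_toFibre_lt (X := X) hε fun x => by simpa [h x] using hε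

end Localization

end CXAlgebra
end

/-! ### Cohen factorization along a positive element -/

noncomputable section

namespace CohenFactorization

open Filter Topology

variable {𝒜 : Type*} [CStarAlgebra 𝒜]

/-- Self-adjoint elements with nonnegative spectrum. -/
structure IsPositive (G : 𝒜) : Prop where
  isSelfAdjoint : IsSelfAdjoint G
  nonneg : ∀ t ∈ spectrum ℝ G, 0 ≤ t

/-- `δ (G + δ)⁻¹` for a positive element `G`, defined by functional calculus. -/
def resolv (G : 𝒜) (δ : ℝ) : 𝒜 := cfc (fun t : ℝ => δ / (t + δ)) G

section Resolvent

variable {G : 𝒜} (hG : IsPositive G)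

include hG in
lemma continuousOn_resolv {δ : ℝ} (hδ : 0 < δ) :
    ContinuousOn (fun t : ℝ => δ / (t + δ)) (spectrum ℝ G) :=
  continuousOn_const.div (by fun_prop) fun t ht => (add_pos_of_nonneg_of_pos (hG.nonneg t ht) hδ).ne'

include hG in
lemma norm_resolv_mul_self_le {δ : ℝ} (hδ : 0 < δ) : ‖resolv G δ * G‖ ≤ δ := by
  have := hG.isSelfAdjoint
  have h : resolv G δ * G = cfc (fun t : ℝ => δ / (t + δ) * t) G := by
    rw [cfc_mul _ _ G (continuousOn_resolv hG hδ) (by fun_prop), cfc_id' ℝ G, resolv]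
  rw [h]
  refine norm_cfc_le hδ.le fun t ht => ?_
  have := hG.nonneg t ht
  rw [Real.norm_of_nonneg (by positivity), div_mul_eq_mul_div, div_le_iff₀ (by positivity)]
  nlinarith

include hG in
-- Decreasing δ only multiplies the resolvent by a contraction, so one small δ can serve finitely
-- many local estimates.
lemma exists_resolv_eq_mul {δ δ' : ℝ} (hδ' : 0 < δ') (h : δ' ≤ δ) :
    ∃ S : 𝒜, ‖S‖ ≤ 1 ∧ resolv G δ' = S * resolv G δ := by
  have := hG.isSelfAdjoint
  have hδ : 0 < δ := hδ'.trans_le h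
  have hc : ContinuousOn (fun t : ℝ => δ' / (t + δ') * ((t + δ) / δ)) (spectrum ℝ G) :=
    (continuousOn_resolv hG hδ').mul (by fun_prop)
  refine ⟨cfc (fun t : ℝ => δ' / (t + δ') * ((t + δ) / δ)) G, norm_cfc_le zero_le_one
    fun t ht => ?_, ?_⟩
  · have := hG.nonneg t ht
    rw [Real.norm_of_nonneg (by positivity), div_mul_div_comm, div_le_one (by positivity)]
    nlinarith
  · rw [resolv, resolv, ← cfc_mul _ _ G hc (continuousOn_resolv hG hδ)]
    refine cfc_congr fun t ht => ?_
    have := hG.nonneg t ht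
    have h₁ : t + δ ≠ 0 := by positivity
    have h₂ : t + δ' ≠ 0 := by positivity
    field_simp

lemma exists_isPositive_hasSum (S : ℕ → 𝒜) (hS : ∀ k, ‖S k‖ ≤ (1 / 2) ^ k) :
    ∃ G : 𝒜, IsPositive G ∧ HasSum (fun k => star (S k) * S k) G := by
  let : PartialOrder 𝒜 := CStarAlgebra.spectralOrder 𝒜
  have : StarOrderedRing 𝒜 := CStarAlgebra.spectralOrderedRing 𝒜
  have hsum : Summable fun k => star (S k) * S k := by
    refine Summable.of_norm_bounded (g := fun k => (1 / 2 : ℝ) ^ k)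
      (summable_geometric_of_lt_one (by norm_num) (by norm_num)) fun k => ?_
    rw [CStarRing.norm_star_mul_self]
    have h₁ : ‖S k‖ ≤ 1 := (hS k).trans (pow_le_one₀ (by norm_num) (by norm_num))
    exact (mul_le_of_le_one_left (norm_nonneg _) h₁).trans (hS k)
  have h0 : 0 ≤ ∑' k, star (S k) * S k := tsum_nonneg fun k => star_mul_self_nonneg _
  exact ⟨_, ⟨.of_nonneg h0, fun t ht => spectrum_nonneg_of_nonneg h0 ht⟩, hsum.hasSum⟩

end Resolvent

variable {E : Type*} [NormedAddCommGroup E] [NormedSpace ℂ E] [CompleteSpace E]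

/-- **Cohen factorization** along a single positive element. -/
theorem exists_eq_apply {G : 𝒜} (hG' : IsPositive G)
    (ρ : 𝒜 →ₐ[ℂ] Module.End ℂ E) {C : ℝ} (hC : 0 ≤ C)
    (hρ : ∀ T v, ‖ρ T v‖ ≤ C * ‖T‖ * ‖v‖) {v : E}
    (hv : ∀ ε > 0, ∃ δ > 0, ‖ρ (resolv G δ) v‖ ≤ ε) :
    ∃ T ∈ closure (Set.range fun S : 𝒜 => G * S), ∃ w, v = ρ T w := by
  obtain ⟨hG, hpos⟩ := id hG'
  choose! d hd hdv using hv
  set δ : ℕ → ℝ := fun k => d ((1 / 4) ^ (k + 1)) with hδdef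
  -- The decay 4⁻ᵏ is chosen to beat the growth 2ᵐ of the inverses of `τ m` below.
  have hδ (k : ℕ) : 0 < δ k := hd _ (by positivity)
  have hδv (k : ℕ) : ‖ρ (resolv G (δ k)) v‖ ≤ (1 / 4) ^ (k + 1) := hdv _ (by positivity)
  have hcd (k : ℕ) : ContinuousOn (fun t : ℝ => (1 / 2) ^ (k + 1) / (t + δ k)) (spectrum ℝ G) :=
    continuousOn_const.div (by fun_prop)
      fun t ht => (add_pos_of_nonneg_of_pos (hpos t ht) (hδ k)).ne'
  set σ : ℕ → ℝ → ℝ := fun m t => ∑ k ∈ Finset.range m, (1 / 2) ^ (k + 1) / (t + δ k) with hσ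
  have hσc (m : ℕ) : ContinuousOn (σ m) (spectrum ℝ G) :=
    continuousOn_finsetSum _ fun k _ => hcd k
  have hσ0 (m : ℕ) (t : ℝ) (ht : t ∈ spectrum ℝ G) : 0 ≤ σ m t :=
    Finset.sum_nonneg fun k _ => by have := hpos t ht; have := hδ k; positivity
  have hid : ContinuousOn (fun t : ℝ => t) (spectrum ℝ G) := continuousOn_id
  have hidσ (m : ℕ) : ContinuousOn (fun t => t * σ m t) (spectrum ℝ G) := hid.mul (hσc m)
  -- Cohen's device: `τ m` is invertible on the spectrum, while its limit differs from the multiples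
  -- t · `σ m` t by errors 2⁻ᵐ plus convergence errors. Successive differences are multiples of
  -- resolvents, so both `τ m`(G) and `τ m`(G)⁻¹ v converge.
  set τ : ℕ → ℝ → ℝ := fun m t => (1 / 2) ^ m + t * σ m t with hτ
  have hτc (m : ℕ) : ContinuousOn (τ m) (spectrum ℝ G) :=
    continuousOn_const.add (hidσ m)
  have hτ_low (m : ℕ) (t : ℝ) (ht : t ∈ spectrum ℝ G) : (1 / 2) ^ m ≤ τ m t :=
    le_add_of_nonneg_right (mul_nonneg (hpos t ht) (hσ0 m t ht))
  have hτ_pos (m : ℕ) (t : ℝ) (ht : t ∈ spectrum ℝ G) : 0 < τ m t :=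
    (by positivity : (0 : ℝ) < (1 / 2) ^ m).trans_le (hτ_low m t ht)
  have hτ_succ (m : ℕ) (t : ℝ) (ht : t ∈ spectrum ℝ G) :
      τ m t - τ (m + 1) t = (1 / 2) ^ (m + 1) * (δ m / (t + δ m)) := by
    have h₁ : t + δ m ≠ 0 := (add_pos_of_nonneg_of_pos (hpos t ht) (hδ m)).ne'
    simp only [hτ, hσ, Finset.sum_range_succ]
    field_simp
    ring
  have hinv_c (m : ℕ) : ContinuousOn (fun t => (τ m t)⁻¹) (spectrum ℝ G) :=
    (hτc m).inv₀ fun t ht => (hτ_pos m t ht).ne'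
  have hinv_le (m : ℕ) (t : ℝ) (ht : t ∈ spectrum ℝ G) : (τ m t)⁻¹ ≤ 2 ^ m := by
    have := inv_anti₀ (by positivity) (hτ_low m t ht)
    simpa using this
  set T : ℕ → 𝒜 := fun m => cfc (τ m) G with hT
  have hT_dist (m : ℕ) : dist (T m) (T (m + 1)) ≤ 1 / 2 * (1 / 2) ^ m := by
    rw [dist_eq_norm, hT, ← cfc_sub _ _ G (hτc m) (hτc (m + 1))]
    refine norm_cfc_le (by positivity) fun t ht => ?_
    have h₁ := hpos t ht
    have h₂ := hδ m
    rw [hτ_succ m t ht, Real.norm_of_nonneg (by positivity), pow_succ']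
    refine mul_le_of_le_one_right (by positivity) ?_
    rw [div_le_one (by positivity)]
    linarith
  obtain ⟨T₀, hT₀⟩ := cauchySeq_tendsto_of_complete
    (cauchySeq_of_le_geometric _ _ (by norm_num) hT_dist)
  set w : ℕ → E := fun m => ρ (cfc (fun t => (τ m t)⁻¹) G) v with hw
  have hTw (m : ℕ) : ρ (T m) (w m) = v := by
    have h1 : T m * cfc (fun t => (τ m t)⁻¹) G = 1 := by
      rw [hT, ← cfc_mul _ _ G (hτc m) (hinv_c m),
        cfc_congr (g := fun _ => (1 : ℝ)) fun t ht => mul_inv_cancel₀ (hτ_pos m t ht).ne',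
        cfc_const_one ℝ G]
    rw [hw, ← Module.End.mul_apply, ← map_mul, h1, map_one, Module.End.one_apply]
  have hw_dist (m : ℕ) : dist (w m) (w (m + 1)) ≤ C * (1 / 2) * (1 / 2) ^ m := by
    have hqc : ContinuousOn (fun t => (τ m t)⁻¹ * (τ (m + 1) t)⁻¹ * (1 / 2) ^ (m + 1))
        (spectrum ℝ G) := ((hinv_c m).mul (hinv_c (m + 1))).mul continuousOn_const
    have hq : cfc (fun t => (τ (m + 1) t)⁻¹) G - cfc (fun t => (τ m t)⁻¹) G =
        cfc (fun t => (τ m t)⁻¹ * (τ (m + 1) t)⁻¹ * (1 / 2) ^ (m + 1)) G * resolv G (δ m) := by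
      rw [resolv, ← cfc_mul _ _ G hqc (continuousOn_resolv hG' (hδ m)),
        ← cfc_sub _ _ G (hinv_c (m + 1)) (hinv_c m)]
      refine cfc_congr fun t ht => ?_
      have h₁ := hτ_succ m t ht
      have h₂ := (hτ_pos m t ht).ne'
      have h₃ := (hτ_pos (m + 1) t ht).ne'
      rw [mul_assoc, ← h₁]
      field_simp
    have hqn : ‖cfc (fun t => (τ m t)⁻¹ * (τ (m + 1) t)⁻¹ * (1 / 2) ^ (m + 1)) G‖ ≤ 2 ^ m := by
      refine norm_cfc_le (by positivity) fun t ht => ?_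
      have h₂ := (hτ_pos m t ht).le
      have h₃ := (hτ_pos (m + 1) t ht).le
      rw [Real.norm_of_nonneg (by positivity)]
      calc _ ≤ (2 : ℝ) ^ m * 2 ^ (m + 1) * (1 / 2) ^ (m + 1) := by
            gcongr
            · exact hinv_le m t ht
            · exact hinv_le (m + 1) t ht
        _ = 2 ^ m := by rw [mul_assoc, ← mul_pow]; norm_num
    rw [dist_comm, dist_eq_norm, hw, ← LinearMap.sub_apply, ← map_sub, hq, map_mul,
      Module.End.mul_apply]
    calc _ ≤ C * 2 ^ m * (1 / 4) ^ (m + 1) := (hρ _ _).trans (by gcongr; exact hδv m)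
      _ ≤ C * 2 ^ m * ((1 / 2) * (1 / 4) ^ m) := by
        gcongr
        rw [pow_succ']
        gcongr
        norm_num
      _ = C * (1 / 2) * (2 * (1 / 4)) ^ m := by rw [mul_pow]; ring
      _ = _ := by norm_num
  obtain ⟨w₀, hw₀⟩ := cauchySeq_tendsto_of_complete
    (cauchySeq_of_le_geometric _ _ (by norm_num) hw_dist)
  refine ⟨T₀, ?_, w₀, ?_⟩
  · have hT' : Tendsto (fun m => cfc (fun t => t * σ m t) G) atTop (𝓝 T₀) := by
      have h₁ : Tendsto (fun m => cfc (fun t => t * σ m t) G - T m) atTop (𝓝 0) := by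
        refine squeeze_zero_norm (a := fun m => (1 / 2 : ℝ) ^ m) (fun m => ?_)
          (tendsto_pow_atTop_nhds_zero_of_lt_one (by norm_num) (by norm_num))
        rw [hT, ← cfc_sub _ _ G (hidσ m) (hτc m)]
        exact norm_cfc_le (by positivity) fun t ht => by simp [hτ]
      simpa using h₁.add hT₀
    refine mem_closure_of_tendsto hT' (Eventually.of_forall fun m => ⟨cfc (σ m) G, ?_⟩)
    simp only
    rw [cfc_mul _ _ G hid (hσc m), cfc_id' ℝ G]
  · refine tendsto_nhds_unique tendsto_const_nhds (?_ : Tendsto (fun _ : ℕ => v) atTop _)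
    have h : Tendsto (fun m => ρ (T m) (w m) - ρ T₀ w₀) atTop (𝓝 0) := by
      have hb : Tendsto (fun m => C * ‖T m - T₀‖ * ‖w m‖ + C * ‖T₀‖ * ‖w m - w₀‖) atTop (𝓝 0) := by
        have h₁ := (tendsto_iff_norm_sub_tendsto_zero.mp hT₀)
        have h₂ := (tendsto_iff_norm_sub_tendsto_zero.mp hw₀)
        simpa using ((h₁.const_mul C).mul hw₀.norm).add (h₂.const_mul (C * ‖T₀‖))
      refine squeeze_zero_norm (fun m => ?_) hb
      have e : ρ (T m) (w m) - ρ T₀ w₀ = ρ (T m - T₀) (w m) + ρ T₀ (w m - w₀) := by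
        rw [map_sub, map_sub, LinearMap.sub_apply]; abel
      rw [e]
      exact (norm_add_le _ _).trans (add_le_add (hρ _ _) (hρ _ _))
    simp only [hTw] at h
    simpa using h.add_const (ρ T₀ w₀)

end CohenFactorization
end

/-! ### Proximal points of seminorms -/

noncomputable section

namespace Seminorm

open Filter Topology

variable {H : Type*} [NormedAddCommGroup H] [InnerProductSpace ℂ H]

/-- The functional whose minimiser is the proximal point of `v` for the seminorm `c • N`. -/
def proxFun (N : Seminorm ℂ H) (c : ℝ) (v : H) (u : H) : ℝ := c * N u + ‖v - u‖ ^ 2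

/-- Strong convexity: compare p with the midpoint of u and p and use the parallelogram law. -/
lemma proxFun_add_half_sq_le {N : Seminorm ℂ H} {c : ℝ} (hc : 0 ≤ c) {v p : H}
    (hp : ∀ u, proxFun N c v p ≤ proxFun N c v u) (u : H) :
    proxFun N c v p + ‖u - p‖ ^ 2 / 2 ≤ proxFun N c v u := by
  have h := hp ((1 / 2 : ℂ) • (u + p))
  have h₁ : N ((1 / 2 : ℂ) • (u + p)) ≤ (N u + N p) / 2 := by
    rw [map_smul_eq_mul]
    have := map_add_le_add N u p
    norm_num
    linarith
  have h₂ := parallelogram_law_with_norm ℂ (v - u) (v - p)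
  have e₁ : v - u + (v - p) = (2 : ℂ) • (v - (1 / 2 : ℂ) • (u + p)) := by
    rw [smul_sub, smul_smul, two_smul]; norm_num; abel
  have e₂ : v - u - (v - p) = -(u - p) := by abel
  rw [e₁, e₂, norm_neg, norm_smul] at h₂
  have e₃ : ‖(2 : ℂ)‖ = 2 := by norm_num
  rw [e₃] at h₂
  have h₃ := mul_le_mul_of_nonneg_left h₁ hc
  simp only [proxFun] at *
  nlinarith

/-- Moving p along the kernel of N does not increase the N-term, so minimality makes v - p
orthogonal to it. -/
lemma inner_eq_zero_of_isMin {N : Seminorm ℂ H} {c : ℝ} (hc : 0 ≤ c) {v p : H}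
    (hp : ∀ u, proxFun N c v p ≤ proxFun N c v u) {κ : H} (hκ : N κ = 0) :
    inner ℂ κ (v - p) = 0 := by
  set z : ℂ := inner ℂ κ (v - p) with hz
  -- This step length keeps the quadratic term at most half of the linear gain.
  set s : ℝ := (‖κ‖ ^ 2 + 1)⁻¹ with hs
  have h := hp (p + ((s : ℂ) * z) • κ)
  have hN : N (p + ((s : ℂ) * z) • κ) ≤ N p := by
    refine (map_add_le_add N _ _).trans ?_
    rw [map_smul_eq_mul, hκ]; simp
  have e : v - (p + ((s : ℂ) * z) • κ) = (v - p) - ((s : ℂ) * z) • κ := by abel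
  have hns : ‖(v - p) - ((s : ℂ) * z) • κ‖ ^ 2 =
      ‖v - p‖ ^ 2 - 2 * s * ‖z‖ ^ 2 + s ^ 2 * ‖z‖ ^ 2 * ‖κ‖ ^ 2 := by
    rw [@norm_sub_sq ℂ, inner_smul_right, ← inner_conj_symm, ← hz, mul_assoc, Complex.mul_conj,
      norm_smul, norm_mul, Complex.norm_real, mul_pow, mul_pow, Real.norm_eq_abs, sq_abs,
      Complex.normSq_eq_norm_sq, ← Complex.ofReal_mul, RCLike.re_to_complex, Complex.ofReal_re]
    ring
  have hs0 : 0 < s := by positivity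
  have hsκ : s * ‖κ‖ ^ 2 ≤ 1 := by
    rw [hs, inv_mul_le_one₀ (by positivity)]
    linarith
  rw [proxFun, proxFun, e, hns] at h
  have h₁ : 2 * s * ‖z‖ ^ 2 ≤ s * ‖z‖ ^ 2 := by
    have h₂ := mul_le_mul_of_nonneg_left hN hc
    have h₃ : s * ‖z‖ ^ 2 * (s * ‖κ‖ ^ 2) ≤ s * ‖z‖ ^ 2 * 1 := by gcongr
    nlinarith
  have h₂ : s * ‖z‖ ^ 2 ≤ 0 := by linarith
  have h₃ : ‖z‖ ^ 2 ≤ 0 := nonpos_of_mul_nonpos_right h₂ hs0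
  simpa using h₃

variable [FiniteDimensional ℂ H]

lemma exists_isMin_proxFun {N : Seminorm ℂ H} (hN : Continuous N) {c : ℝ} (hc : 0 ≤ c) (v : H) :
    ∃ p, ∀ u, proxFun N c v p ≤ proxFun N c v u := by
  have : ProperSpace H := FiniteDimensional.proper ℂ H
  have hcont : Continuous (proxFun N c v) := by unfold proxFun; fun_prop
  obtain ⟨p, hp⟩ := hcont.exists_forall_le' (x₀ := 0) (by
    filter_upwards [(isCompact_closedBall (0 : H) (2 * ‖v‖)).compl_mem_cocompact] with u hu
    have hu : 2 * ‖v‖ < ‖u‖ := by simpa using hu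
    have h₁ : ‖v‖ ≤ ‖v - u‖ := by
      have := norm_sub_norm_le u v
      rw [norm_sub_rev] at this
      linarith
    have h₂ : 0 ≤ c * N u := mul_nonneg hc (apply_nonneg _ _)
    have h₃ := pow_le_pow_left₀ (norm_nonneg _) h₁ 2
    simp only [proxFun, map_zero, sub_zero]
    linarith)
  exact ⟨p, hp⟩

/-- For a continuous family of seminorms on a finite-dimensional space, every vector admits a
continuous family of approximations orthogonal to the kernels. -/
theorem exists_continuous_orthogonal {X : Type*} [TopologicalSpace X] (N : X → Seminorm ℂ H)
    {C : NNReal} (hC : ∀ x u, N x u ≤ C * ‖u‖) (hN : ∀ u, Continuous fun x => N x u)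
    {c : ℝ} (hc : 0 < c) (v : H) :
    ∃ r : C(X, H), (∀ x κ, N x κ = 0 → inner ℂ κ (r x) = 0) ∧ (∀ x, ‖r x‖ ≤ ‖v‖) ∧
      ∀ x, c * N x (v - r x) ≤ ‖v‖ ^ 2 := by
  have hlip (x : X) : LipschitzWith C (N x) := .of_dist_le_mul fun u u' => by
    rw [Real.dist_eq, dist_eq_norm]
    exact (abs_sub_map_le_sub (N x) u u').trans (hC x _)
  have hjoint : Continuous fun q : X × H => N q.1 q.2 :=
    (continuous_prod_of_continuous_lipschitzWith (fun q : H × X => N q.2 q.1) C hN hlip).comp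
      continuous_swap
  have hNx (x : X) : Continuous (N x) := (hlip x).continuous
  have : ProperSpace H := FiniteDimensional.proper ℂ H
  choose p hp using fun x => exists_isMin_proxFun (hNx x) hc.le v
  have h0 (x : X) : c * N x (p x) + ‖v - p x‖ ^ 2 ≤ ‖v‖ ^ 2 := by
    simpa [proxFun] using hp x 0
  have hr (x : X) : ‖v - p x‖ ≤ ‖v‖ := by
    have h₁ : 0 ≤ c * N x (p x) := mul_nonneg hc.le (apply_nonneg _ _)
    exact le_of_sq_le_sq (by linarith [h0 x]) (norm_nonneg _)
  have hpn (x : X) : ‖p x‖ ≤ 2 * ‖v‖ := by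
    have := norm_sub_norm_le (p x) v
    rw [norm_sub_rev] at this
    linarith [hr x]
  have hcont : Continuous p := by
    refine continuous_iff_continuousAt.mpr fun x => Metric.tendsto_nhds.mpr fun ε hε => ?_
    -- Adding the strong convexity inequalities at x and y gives ‖p y - p x‖² ≤ 2cη = ε²/2.
    set η : ℝ := ε ^ 2 / (4 * c) with hη
    have hη0 : 0 < η := by positivity
    have hev : ∀ᶠ y in 𝓝 x, ∀ u ∈ Metric.closedBall (0 : H) (2 * ‖v‖), |N y u - N x u| < η := by
      refine (isCompact_closedBall _ _).eventually_forall_of_forall_eventually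
        (P := fun y u => |N y u - N x u| < η) fun u _ => ?_
      have hc' : Continuous fun q : X × H => |N q.1 q.2 - N x q.2| :=
        (hjoint.sub ((hNx x).comp continuous_snd)).abs
      exact hc'.continuousAt.eventually_lt_const (by simpa using hη0)
    filter_upwards [hev] with y hy
    have h₁ := abs_lt.mp (hy (p y) (by simpa using hpn y))
    have h₂ := abs_lt.mp (hy (p x) (by simpa using hpn x))
    have h₃ := proxFun_add_half_sq_le hc.le (hp x) (p y)
    have h₄ := proxFun_add_half_sq_le hc.le (hp y) (p x)
    rw [norm_sub_rev] at h₄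
    simp only [proxFun] at h₃ h₄
    have h₅ : c * (N x (p y) - N y (p y)) ≤ c * η := by gcongr; linarith
    have h₆ : c * (N y (p x) - N x (p x)) ≤ c * η := by gcongr; linarith
    have h₇ : c * η = ε ^ 2 / 4 := by rw [hη]; field_simp
    rw [dist_eq_norm]
    refine lt_of_pow_lt_pow_left₀ 2 hε.le ?_
    nlinarith
  refine ⟨⟨fun x => v - p x, continuous_const.sub hcont⟩,
    fun x κ hκ => inner_eq_zero_of_isMin hc.le (hp x) hκ, hr, fun x => ?_⟩
  have := h0 x
  simp only [ContinuousMap.coe_mk, sub_sub_cancel]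
  nlinarith [sq_nonneg ‖v - p x‖]

/-- A cluster point s₀ of s satisfies w - s₀ ∈ ker N, so both w - s₀ and w are orthogonal to s₀.
Hence s₀ = 0 and w ∈ ker N. -/
lemma eq_zero_of_tendsto_orthogonal {N : Seminorm ℂ H} (hN : Continuous N) {w : H} {s : ℕ → H}
    {R : ℝ} (hs : ∀ k, ‖s k‖ ≤ R) (hNs : Tendsto (fun k => N (w - s k)) atTop (𝓝 0))
    (hws : ∀ k, inner ℂ w (s k) = 0) (hκ : ∀ κ, N κ = 0 → ∀ k, inner ℂ κ (s k) = 0) : N w = 0 := by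
  have : ProperSpace H := FiniteDimensional.proper ℂ H
  obtain ⟨s₀, _, φ, hφ, h⟩ := tendsto_subseq_of_bounded (Metric.isBounded_closedBall (x := (0 : H)) (r := R))
    (fun k => by simpa using hs k)
  have hlim {u : H} (hu : ∀ k, inner ℂ u (s k) = 0) : inner ℂ u s₀ = 0 := by
    refine tendsto_nhds_unique ((tendsto_const_nhds (x := u)).inner h) ?_
    simp [hu]
  have h₁ : N (w - s₀) = 0 :=
    tendsto_nhds_unique ((hN.tendsto _).comp (tendsto_const_nhds.sub h))
      (hNs.comp hφ.tendsto_atTop)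
  have h₂ := hlim (hκ _ h₁)
  rw [inner_sub_left, hlim hws, zero_sub, neg_eq_zero, inner_self_eq_zero] at h₂
  simpa [h₂] using h₁

end Seminorm
end

/-! ### Matrices over C(X) acting on tuples -/

noncomputable section

lemma LinearMap.exists_eq_comp_of_ker_le {K U V W : Type*} [Field K] [AddCommGroup U] [Module K U]
    [AddCommGroup V] [Module K V] [AddCommGroup W] [Module K W] (f : U →ₗ[K] V) (g : U →ₗ[K] W)
    (h : LinearMap.ker f ≤ LinearMap.ker g) : ∃ φ : V →ₗ[K] W, ∀ u, g u = φ (f u) := by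
  obtain ⟨φ, hφ⟩ := LinearMap.exists_extend
    ((LinearMap.ker f).liftQ g h ∘ₗ f.quotKerEquivRange.symm.toLinearMap)
  refine ⟨φ, fun u => ?_⟩
  have := LinearMap.congr_fun hφ ⟨f u, u, rfl⟩
  have e : f.quotKerEquivRange.symm ⟨f u, u, rfl⟩ = (LinearMap.ker f).mkQ u := by
    rw [LinearEquiv.symm_apply_eq]
    rfl
  simp only [LinearMap.comp_apply, Submodule.subtype_apply, LinearEquiv.coe_coe, e] at this
  rw [this]
  simp

namespace CXAlgebra

open Topology Filter CohenFactorization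
open scoped ComplexOrder

variable {X A ι : Type*} [TopologicalSpace X] [Fintype ι]

section

variable [CompactSpace X]

/-- The coordinate `T ↦ T i j x` of matrices over `C(X)`. -/
def entryCLM (i j : ι) (x : X) : CStarMatrix ι ι C(X, ℂ) →L[ℂ] ℂ :=
  LinearMap.mkContinuous
    { toFun := fun T => T i j x
      map_add' := fun S T => by simp
      map_smul' := fun c T => by simp } 1 fun T => by
    rw [one_mul]
    exact ((T i j).norm_coe_le_norm x).trans CStarMatrix.norm_entry_le_norm

@[simp] lemma entryCLM_apply (i j : ι) (x : X) (T : CStarMatrix ι ι C(X, ℂ)) :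
    entryCLM i j x T = T i j x := rfl

end

variable [DecidableEq ι]

variable [NonUnitalCStarAlgebra A] [CXAlgebra X A]

/-- Matrices over `C(X)` act on tuples of elements of a `C(X)`-algebra. -/
def matrixAct : CStarMatrix ι ι C(X, ℂ) →ₐ[ℂ] Module.End ℂ (ι → A) :=
  AlgHom.ofLinearMap
    { toFun := fun T => LinearMap.pi fun i => ∑ j, actHom X A (T i j) ∘ₗ LinearMap.proj j
      map_add' := fun S T => by
        ext; simp [LinearMap.add_comp, Finset.sum_add_distrib]
      map_smul' := fun c T => by
        ext; simp [LinearMap.smul_comp, Finset.smul_sum] }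
    (by
      refine LinearMap.ext fun v => funext fun i => ?_
      have h (j : ι) : act (if i = j then 1 else 0 : C(X, ℂ)) (v j) = if i = j then v j else 0 := by
        split_ifs <;> simp
      simp [CStarMatrix.one_apply, actHom_apply, h])
    (by
      intro S T
      refine LinearMap.ext fun v => funext fun i => ?_
      simp only [LinearMap.coe_mk, AddHom.coe_mk, LinearMap.pi_apply, LinearMap.sum_apply,
        LinearMap.comp_apply, LinearMap.proj_apply, Module.End.mul_apply, CStarMatrix.mul_apply,
        actHom_apply, sum_act, act_sum, mul_act]
      exact Finset.sum_comm)

lemma matrixAct_apply (T : CStarMatrix ι ι C(X, ℂ)) (v : ι → A) (i : ι) :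
    matrixAct T v i = ∑ j, act (T i j) (v j) := by
  simp [matrixAct, actHom_apply]

lemma toFibre_matrixAct (T : CStarMatrix ι ι C(X, ℂ)) (v : ι → A) (i : ι) (x : X) :
    toFibre A x (matrixAct T v i) = ∑ j, T i j x • toFibre A x (v j) := by
  simp [matrixAct_apply, toFibre_act]

variable [CompactSpace X]

lemma norm_matrixAct_le (T : CStarMatrix ι ι C(X, ℂ)) (v : ι → A) :
    ‖matrixAct T v‖ ≤ Fintype.card ι * ‖T‖ * ‖v‖ := by
  rw [pi_norm_le_iff_of_nonneg (by positivity)]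
  intro i
  rw [matrixAct_apply]
  calc _ ≤ ∑ j, ‖act (T i j) (v j)‖ := norm_sum_le _ _
    _ ≤ ∑ j : ι, ‖T‖ * ‖v‖ := by
      gcongr with j
      refine (norm_act_le _ _).trans ?_
      gcongr
      · exact CStarMatrix.norm_entry_le_norm
      · exact norm_le_pi_norm v j
    _ = _ := by simp [mul_assoc]

lemma norm_toFibre_matrixAct_le (T : CStarMatrix ι ι C(X, ℂ)) (v : ι → A) (x : X) {ε : ℝ}
    (h : ∀ j, ‖toFibre A x (v j)‖ ≤ ε) (i : ι) :
    ‖toFibre A x (matrixAct T v i)‖ ≤ Fintype.card ι * ‖T‖ * ε := by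
  rw [toFibre_matrixAct]
  calc _ ≤ ∑ j, ‖T i j x • toFibre A x (v j)‖ := norm_sum_le _ _
    _ ≤ ∑ j : ι, ‖T‖ * ε := by
      gcongr with j
      rw [norm_smul]
      gcongr
      · exact ((T i j).norm_coe_le_norm x).trans CStarMatrix.norm_entry_le_norm
      · exact h j
    _ = _ := by simp [mul_assoc]

/-- A tuple lying fibrewise in the range of a positive matrix `G` over `C(X)` factors through
a matrix in the closed right ideal generated by `G`. -/
theorem exists_eq_matrixAct [T2Space X] {G : CStarMatrix ι ι C(X, ℂ)} (hG : IsPositive G) (a : ι → A)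
    (ha : ∀ x : X, ∃ c : ι → A, ∀ i, toFibre A x (a i) = toFibre A x (matrixAct G c i)) :
    ∃ T ∈ closure (Set.range fun S => G * S), ∃ a' : ι → A, a = matrixAct T a' := by
  refine exists_eq_apply hG (matrixAct (X := X) (A := A)) (C := (Fintype.card ι : ℝ)) (by positivity) norm_matrixAct_le
    fun ε hε => ?_
  set N : ℝ := (Fintype.card ι : ℝ) with hN
  have hN0 : 0 ≤ N := by positivity
  have hloc (x : X) : ∃ δ > 0, ∀ i, ‖toFibre A x (matrixAct (resolv G δ) a i)‖ < ε / (N + 1) := by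
    obtain ⟨c, hc⟩ := ha x
    set δ : ℝ := ε / (N + 1) / (N * ‖c‖ + 1) with hδ
    have hδ0 : 0 < δ := by positivity
    refine ⟨δ, hδ0, fun i => ?_⟩
    -- In the fibre at x the tuple is G c, and δ(G + δ)⁻¹ G has norm at most δ.
    have e : toFibre A x (matrixAct (resolv G δ) a i) =
        toFibre A x (matrixAct (resolv G δ * G) c i) := by
      rw [map_mul, Module.End.mul_apply, toFibre_matrixAct, toFibre_matrixAct]
      simp only [hc]
    rw [e]
    calc _ ≤ ‖matrixAct (resolv G δ * G) c i‖ := norm_toFibre_le _ _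
      _ ≤ ‖matrixAct (resolv G δ * G) c‖ := norm_le_pi_norm _ i
      _ ≤ N * δ * ‖c‖ := (norm_matrixAct_le _ _).trans (by
        gcongr
        exact norm_resolv_mul_self_le hG hδ0)
      _ < δ * (N * ‖c‖ + 1) := by linarith
      _ = _ := by rw [hδ]; field_simp
  choose δ hδ0 hδ using hloc
  -- Upper semicontinuity spreads each estimate to a neighbourhood; compactness and monotonicity in
  -- δ then give a uniform one.
  obtain ⟨t, ht⟩ := CompactSpace.elim_nhds_subcover
    (fun x => {y | ∀ i, ‖toFibre A y (matrixAct (resolv G (δ x)) a i)‖ < ε / (N + 1)})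
    fun x => Filter.eventually_all.mpr fun i => eventually_norm_toFibre_lt (hδ x i)
  obtain ⟨η, hη0, hη⟩ : ∃ η > 0, ∀ x ∈ t, η ≤ δ x := by
    refine ⟨(insert 1 (t.image δ)).min' (Finset.insert_nonempty _ _), ?_, fun x hx => ?_⟩
    · rw [gt_iff_lt, Finset.lt_min'_iff]
      simp only [Finset.mem_insert, Finset.mem_image, forall_eq_or_imp, zero_lt_one, true_and]
      rintro _ ⟨x, -, rfl⟩
      exact hδ0 x
    · exact Finset.min'_le _ _ (Finset.mem_insert_of_mem (Finset.mem_image_of_mem δ hx))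
  refine ⟨η, hη0, (pi_norm_le_iff_of_nonneg hε.le).mpr fun i => ?_⟩
  refine norm_le_of_forall_norm_toFibre_lt (X := X) hε fun y => ?_
  obtain ⟨x, hx, hy⟩ : ∃ x ∈ t, ∀ i, ‖toFibre A y (matrixAct (resolv G (δ x)) a i)‖ < ε / (N + 1) := by
    simpa using ht.ge (Set.mem_univ y)
  obtain ⟨S, hS, hSr⟩ := exists_resolv_eq_mul hG hη0 (hη x hx)
  rw [hSr, map_mul, Module.End.mul_apply]
  calc _ ≤ N * ‖S‖ * (ε / (N + 1)) := norm_toFibre_matrixAct_le S _ y (fun j => (hy j).le) i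
    _ ≤ N * 1 * (ε / (N + 1)) := by gcongr
    _ < (N + 1) * (ε / (N + 1)) := by gcongr; linarith
    _ = ε := by field_simp

end CXAlgebra
end

/-! ### The matrix encoding fibrewise linear relations -/

noncomputable section

namespace CXAlgebra

open Topology Filter CohenFactorization
open scoped ComplexOrder ComplexConjugate

variable {X A ι : Type*} [TopologicalSpace X] [Fintype ι]

lemma sum_mul_star_mul_self_apply (S : CStarMatrix ι ι C(X, ℂ)) (κ : ι → ℂ) (l : ι) (x : X) :
    ∑ i, κ i * (star S * S) i l x = ∑ j, (∑ i, κ i * conj (S j i x)) * S j l x := by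
  simp only [CStarMatrix.mul_apply, CStarMatrix.star_apply, ContinuousMap.sum_apply,
    ContinuousMap.mul_apply, ContinuousMap.star_apply, Finset.mul_sum, Finset.sum_mul]
  rw [Finset.sum_comm]
  simp [mul_assoc]

lemma sum_sum_mul_star_mul_self_apply (S : CStarMatrix ι ι C(X, ℂ)) (κ : ι → ℂ) (x : X) :
    ∑ l, (∑ i, κ i * (star S * S) i l x) * conj (κ l) =
      ((∑ j, ‖∑ i, κ i * conj (S j i x)‖ ^ 2 : ℝ) : ℂ) := by
  simp only [sum_mul_star_mul_self_apply, Finset.sum_mul]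
  rw [Finset.sum_comm]
  push_cast
  refine Finset.sum_congr rfl fun j _ => ?_
  rw [← Complex.mul_conj', map_sum, Finset.mul_sum]
  refine Finset.sum_congr rfl fun l _ => ?_
  simp only [map_mul, Complex.conj_conj]
  rw [← Finset.sum_mul, ← Finset.sum_mul]
  ring

variable [NonUnitalCStarAlgebra A] [CXAlgebra X A]

/-- The linear map `λ ↦ ∑ λᵢ aᵢ`. -/
def comb {V : Type*} [AddCommGroup V] [Module ℂ V] (a : ι → V) : EuclideanSpace ℂ ι →ₗ[ℂ] V :=
  Fintype.linearCombination ℂ a ∘ₗ (WithLp.linearEquiv 2 ℂ (ι → ℂ)).toLinearMap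

lemma comb_apply {V : Type*} [AddCommGroup V] [Module ℂ V] (a : ι → V) (u : EuclideanSpace ℂ ι) :
    comb a u = ∑ i, u i • a i := by
  simp [comb, Fintype.linearCombination_apply]

/-- The seminorm `λ ↦ ‖(∑ λᵢ aᵢ)_x‖`. -/
def fibreSeminorm (a : ι → A) (x : X) : Seminorm ℂ (EuclideanSpace ℂ ι) :=
  (normSeminorm ℂ (Fibre A x)).comp (toFibre A x ∘ₗ comb a)

lemma fibreSeminorm_apply (a : ι → A) (x : X) (u : EuclideanSpace ℂ ι) :
    fibreSeminorm a x u = ‖toFibre A x (∑ i, u i • a i)‖ := by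
  rw [← comb_apply]
  rfl

lemma fibreSeminorm_le (a : ι → A) (x : X) (u : EuclideanSpace ℂ ι) :
    fibreSeminorm a x u ≤ (∑ i, ‖a i‖₊ : NNReal) * ‖u‖ := by
  rw [fibreSeminorm_apply]
  refine (norm_toFibre_le _ _).trans ((norm_sum_le _ _).trans ?_)
  push_cast
  rw [Finset.sum_mul]
  gcongr with i
  rw [norm_smul, mul_comm]
  gcongr
  exact PiLp.norm_apply_le u i

variable [CompactSpace X] [DecidableEq ι]

/-- If the fibre norms of all combinations of the `aᵢ` are continuous, then some positive matrix
over `C(X)` has the linear relations between the `(aᵢ)_x` as its left kernel at every `x`. -/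
theorem exists_isPositive_ker (a : ι → A)
    (ha : ∀ u : ι → ℂ, Continuous fun x : X => ‖toFibre A x (∑ i, u i • a i)‖) :
    ∃ G : CStarMatrix ι ι C(X, ℂ), IsPositive G ∧ ∀ (x : X) (κ : ι → ℂ),
      (∀ l, ∑ i, κ i * G i l x = 0) ↔ ∑ i, κ i • toFibre A x (a i) = 0 := by
  have hN (u : EuclideanSpace ℂ ι) : Continuous fun x : X => fibreSeminorm a x u := by
    simpa only [fibreSeminorm_apply] using ha u
  have hNc (x : X) : Continuous (fibreSeminorm a x) :=
    continuous_norm.comp (toFibre A x ∘ₗ comb a).continuous_of_finiteDimensional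
  -- With weight k + 1, `r k j x` approximates the j-th basis vector in the seminorm at x to within
  -- 1/(k + 1).
  choose r hr_orth hr_norm hr_N using fun (k : ℕ) (j : ι) =>
    Seminorm.exists_continuous_orthogonal (fibreSeminorm (X := X) a) (fibreSeminorm_le a) hN
      (c := k + 1) (by positivity) (EuclideanSpace.single j 1)
  set S' : ℕ → CStarMatrix ι ι C(X, ℂ) := fun k =>
    CStarMatrix.ofMatrix fun j i => ⟨fun x => r k j x i, by fun_prop⟩ with hS'
  -- These weights force ‖S k‖ ≤ 2⁻ᵏ, so that ∑ S⋆S converges.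
  set w : ℕ → ℝ := fun k => (1 / 2) ^ k / (1 + ‖S' k‖) with hw
  have hw0 (k : ℕ) : 0 < w k := by positivity
  set S : ℕ → CStarMatrix ι ι C(X, ℂ) := fun k => (w k : ℂ) • S' k with hS
  have hSapp (k : ℕ) (j i : ι) (x : X) : S k j i x = w k * r k j x i := rfl
  obtain ⟨G, hG, hsum⟩ := exists_isPositive_hasSum S fun k => by
    rw [hS, norm_smul, Complex.norm_real, Real.norm_of_nonneg (hw0 k).le, hw]
    simp only
    rw [div_mul_eq_mul_div, div_le_iff₀ (by positivity)]
    gcongr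
    linarith
  have hinner (k : ℕ) (j : ι) (x : X) (κ : ι → ℂ) :
      ∑ i, κ i * conj (S k j i x) = w k * inner ℂ (r k j x) (WithLp.toLp 2 κ) := by
    simp only [hSapp, PiLp.inner_apply, Finset.mul_sum, RCLike.inner_apply, map_mul,
      Complex.conj_ofReal]
    exact Finset.sum_congr rfl fun i _ => by ring
  have hrow (x : X) (κ : ι → ℂ) (l : ι) :
      HasSum (fun k => ∑ i, κ i * (star (S k) * S k) i l x) (∑ i, κ i * G i l x) := by
    have := hsum.mapL (∑ i, κ i • entryCLM i l x)
    simpa using this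
  refine ⟨G, hG, fun x κ => ⟨fun h => ?_, fun h l => ?_⟩⟩
  -- The quadratic form of G at κ is a sum of squares, so its vanishing makes κ orthogonal to every
  -- `r k j x`.
  · have hq : HasSum (fun k => ∑ j, ‖∑ i, κ i * conj (S k j i x)‖ ^ 2) 0 := by
      have := hasSum_sum (s := Finset.univ) fun l _ => (hrow x κ l).mul_right (conj (κ l))
      simp only [h, zero_mul, Finset.sum_const_zero, sum_sum_mul_star_mul_self_apply] at this
      rwa [← Complex.ofReal_zero, Complex.hasSum_ofReal] at this
    rw [hasSum_zero_iff_of_nonneg fun k => by positivity] at hq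
    have horth (k : ℕ) (j : ι) : inner ℂ (r k j x) (WithLp.toLp 2 κ) = 0 := by
      have h₁ := congrFun hq k
      simp only [Pi.zero_apply] at h₁
      rw [Finset.sum_eq_zero_iff_of_nonneg fun j _ => by positivity] at h₁
      have h₂ := h₁ j (Finset.mem_univ j)
      rw [hinner] at h₂
      simpa [(hw0 k).ne'] using h₂
    have hz : fibreSeminorm a x (WithLp.toLp 2 κ) = 0 := by
      refine Seminorm.eq_zero_of_tendsto_orthogonal (hNc x) (s := fun k => ∑ j, κ j • r k j x)
        (R := ∑ j, ‖κ j‖) (fun k => ?_) ?_ (fun k => ?_) fun κ' hκ' k => ?_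
      · refine (norm_sum_le _ _).trans ?_
        gcongr with j
        rw [norm_smul]
        exact mul_le_of_le_one_right (norm_nonneg _) ((hr_norm k j x).trans (by simp))
      · have hlim : Tendsto (fun k : ℕ => (∑ j, ‖κ j‖) * (1 / ((k : ℝ) + 1))) atTop (𝓝 0) := by
          simpa using tendsto_one_div_add_atTop_nhds_zero_nat.const_mul (∑ j, ‖κ j‖)
        refine squeeze_zero (fun k => apply_nonneg _ _) (fun k => ?_) hlim
        have e : WithLp.toLp 2 κ - ∑ j, κ j • r k j x =
            ∑ j, κ j • (EuclideanSpace.single j (1 : ℂ) - r k j x) := by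
          simp only [smul_sub, Finset.sum_sub_distrib]
          congr 1
          ext i
          simp [Finset.sum_apply, Pi.single_apply]
        rw [e, Finset.sum_mul]
        refine (Finset.le_sum_of_subadditive (fibreSeminorm a x) (map_zero _).le
          (map_add_le_add _) _ _).trans ?_
        gcongr with j
        rw [map_smul_eq_mul]
        gcongr
        have := hr_N k j x
        rw [le_div_iff₀ (by positivity), mul_comm]
        simpa using this
      · rw [inner_sum]
        refine Finset.sum_eq_zero fun j _ => ?_
        rw [inner_smul_right, ← inner_conj_symm, horth]
        simp
      · rw [inner_sum]
        refine Finset.sum_eq_zero fun j _ => ?_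
        rw [inner_smul_right, hr_orth k j x κ' hκ', mul_zero]
    rw [fibreSeminorm_apply, norm_eq_zero] at hz
    simpa using hz
  · refine (hrow x κ l).unique ?_
    have hκ : fibreSeminorm a x (WithLp.toLp 2 κ) = 0 := by
      rw [fibreSeminorm_apply, norm_eq_zero]
      simpa using h
    have hzero (k : ℕ) : ∑ i, κ i * (star (S k) * S k) i l x = 0 := by
      rw [sum_mul_star_mul_self_apply]
      refine Finset.sum_eq_zero fun j _ => ?_
      rw [hinner, ← inner_conj_symm, hr_orth k j x _ hκ]
      simp
    simp only [hzero]
    exact hasSum_zero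

/-- A tuple with continuous fibre norms factors through a matrix over `C(X)` that is annihilated by
every linear relation holding between the entries of the tuple in a fibre. -/
theorem exists_factorization [T2Space X] (a : ι → A)
    (ha : ∀ u : ι → ℂ, Continuous fun x : X => ‖toFibre A x (∑ i, u i • a i)‖) :
    ∃ (T : CStarMatrix ι ι C(X, ℂ)) (a' : ι → A), (∀ i, a i = ∑ j, act (T i j) (a' j)) ∧
      ∀ (x : X) (κ : ι → ℂ), ∑ i, κ i • toFibre A x (a i) = 0 → ∀ l, ∑ i, κ i * T i l x = 0 := by
  obtain ⟨G, hG, hker⟩ := exists_isPositive_ker a ha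
  obtain ⟨T, hT, a', ha'⟩ := exists_eq_matrixAct hG a fun x => by
    -- Relations between the rows of G hold between the (aᵢ)_x, so row i ↦ (aᵢ)_x is linear; lifting
    -- the images of the basis vectors gives c.
    obtain ⟨φ, hφ⟩ := LinearMap.exists_eq_comp_of_ker_le
      (LinearMap.pi fun l => Fintype.linearCombination ℂ fun i => G i l x)
      (Fintype.linearCombination ℂ fun i => toFibre A x (a i)) fun κ hκ => by
        rw [LinearMap.mem_ker, Fintype.linearCombination_apply, ← hker]
        intro l
        simpa [Fintype.linearCombination_apply] using congrFun hκ l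
    choose c hc using fun l => toFibre_surjective (A := A) x (φ (Pi.single l 1))
    refine ⟨c, fun i => ?_⟩
    have h := hφ (Pi.single i 1)
    rw [Fintype.linearCombination_apply_single, one_smul] at h
    rw [toFibre_matrixAct, h]
    simp only [hc, ← map_smul, ← map_sum]
    congr 1
    ext l
    simp [Fintype.linearCombination_apply_single, Finset.sum_apply, Pi.single_apply]
  refine ⟨T, a', fun i => by rw [← matrixAct_apply, ← ha'], fun x κ hκ l => ?_⟩
  have hclosed : IsClosed {T : CStarMatrix ι ι C(X, ℂ) | ∑ i, κ i * T i l x = 0} := by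
    have : Continuous fun T => (∑ i, κ i • entryCLM i l x) T :=
      (∑ i, κ i • entryCLM i l x : CStarMatrix ι ι C(X, ℂ) →L[ℂ] ℂ).continuous
    simp only [sum_apply, smul_apply, entryCLM_apply,
      smul_eq_mul] at this
    exact isClosed_eq this continuous_const
  refine closure_minimal ?_ hclosed hT
  rintro _ ⟨S, rfl⟩
  have h0 := (hker x κ).mpr hκ
  simp only [Set.mem_ofPred_eq, CStarMatrix.mul_apply, ContinuousMap.sum_apply,
    ContinuousMap.mul_apply, Finset.mul_sum]
  rw [Finset.sum_comm]
  refine Finset.sum_eq_zero fun j _ => ?_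
  simp only [← mul_assoc, ← Finset.sum_mul, h0, zero_mul]

end CXAlgebra
end

noncomputable section

namespace CXAlgebra

open Topology Filter CohenFactorization
open scoped ComplexOrder

/-! ### Factorization of elements of a fibre ideal -/

section Scalar

variable {X A : Type*} [TopologicalSpace X] [CompactSpace X] [T2Space X] [NonUnitalCStarAlgebra A]
  [CXAlgebra X A]

/-- **Cohen factorization** in the fibre ideal `C_x(X) A`. -/
theorem exists_eq_act_of_mem_fibreIdeal {x : X} {b : A} (hb : b ∈ fibreIdeal A x) :
    ∃ (g : C(X, ℂ)) (c : A), g x = 0 ∧ b = act g c := by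
  have hb0 (k : ℕ) : ‖toFibre A x b‖ < 1 / ((k : ℝ) + 1) := by
    rw [toFibre_eq_zero_iff.mpr hb, norm_zero]
    positivity
  choose ψ h01 h1 hψ using fun k => exists_bump_norm_act_lt (hb0 k)
  set S' : ℕ → CStarMatrix Unit Unit C(X, ℂ) := fun k =>
    CStarMatrix.ofMatrix fun _ _ => 1 - ofRealMap (ψ k) with hS'
  set w : ℕ → ℝ := fun k => (1 / 2) ^ k / (1 + ‖S' k‖) with hw
  have hw0 (k : ℕ) : 0 < w k := by positivity
  set S : ℕ → CStarMatrix Unit Unit C(X, ℂ) := fun k => (w k : ℂ) • S' k with hS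
  have hSapp (k : ℕ) (y : X) : S k () () y = w k * (1 - ψ k y) := rfl
  obtain ⟨G, hG, hsum⟩ := exists_isPositive_hasSum S fun k => by
    rw [hS, norm_smul, Complex.norm_real, Real.norm_of_nonneg (hw0 k).le, hw]
    simp only
    rw [div_mul_eq_mul_div, div_le_iff₀ (by positivity)]
    gcongr
    linarith
  have hGy (y : X) : HasSum (fun k => (((w k * (1 - ψ k y)) ^ 2 : ℝ) : ℂ)) (G () () y) := by
    have := hsum.mapL (entryCLM () () y)
    simpa [CStarMatrix.mul_apply, CStarMatrix.star_apply, hSapp, sq] using this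
  have hGx : G () () x = 0 := by
    refine (hGy x).unique ?_
    have h (k : ℕ) : ψ k x = 1 := (h1 k).self_of_nhds
    simp only [h, sub_self, mul_zero, ne_eq, OfNat.ofNat_ne_zero, not_false_eq_true, zero_pow,
      Complex.ofReal_zero]
    exact hasSum_zero
  -- G vanishes only where every `ψ k` is 1, and there b_y is zero; elsewhere G is invertible. So b
  -- lies fibrewise in the range of G.
  have hby (y : X) (hy : G () () y = 0) : toFibre A y b = 0 := by
    have h := hGy y
    rw [hy, ← Complex.ofReal_zero, Complex.hasSum_ofReal,
      hasSum_zero_iff_of_nonneg fun k => by positivity] at h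
    have hψ1 (k : ℕ) : ψ k y = 1 := by
      have := congrFun h k
      have := (hw0 k).ne'
      simp_all [sub_eq_zero]
    have hk (k : ℕ) : ‖toFibre A y b‖ ≤ 1 / ((k : ℝ) + 1) := by
      refine le_trans ?_ (hψ k).le
      calc ‖toFibre A y b‖ = ‖toFibre A y (act (ofRealMap (ψ k)) b)‖ := by
            simp [toFibre_act, hψ1]
        _ ≤ _ := norm_toFibre_le _ _
    have := ge_of_tendsto' tendsto_one_div_add_atTop_nhds_zero_nat hk
    simpa using this
  obtain ⟨T, hT, c, hc⟩ := exists_eq_matrixAct hG (fun _ => b) fun y => by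
    by_cases hy : G () () y = 0
    · exact ⟨0, fun _ => by simp [hby y hy]⟩
    · refine ⟨fun _ => (G () () y)⁻¹ • b, fun i => ?_⟩
      simp [toFibre_matrixAct, smul_smul, hy]
  refine ⟨T () (), c (), ?_, by simpa [matrixAct_apply] using congrFun hc ()⟩
  have hclosed : IsClosed {T : CStarMatrix Unit Unit C(X, ℂ) | T () () x = 0} :=
    isClosed_eq (entryCLM () () x).continuous continuous_const
  refine closure_minimal ?_ hclosed hT
  rintro _ ⟨S, rfl⟩
  simp [CStarMatrix.mul_apply, hGx]

end Scalar

/-! ### Comparison of the two ideals -/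

section Tensor

variable {X A B : Type*} [TopologicalSpace X] [NonUnitalCStarAlgebra A] [NonUnitalCStarAlgebra B]
  [CXAlgebra X A] [CXAlgebra X B]

lemma ker_map_toFibre (x : X) :
    LinearMap.ker (TensorProduct.map (toFibre A x) (toFibre B x)) =
      Submodule.span ℂ {t | ∃ a b, (a ∈ fibreIdeal A x ∨ b ∈ fibreIdeal B x) ∧ t = a ⊗ₜ[ℂ] b} := by
  apply le_antisymm
  · rw [TensorProduct.map_ker (f := (fibreIdeal A x).subtype) (f' := (fibreIdeal B x).subtype)
      (LinearMap.exact_iff.mpr (by rw [ker_toFibre, Submodule.range_subtype]))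
      (toFibre_surjective x)
      (LinearMap.exact_iff.mpr (by rw [ker_toFibre, Submodule.range_subtype]))
      (toFibre_surjective x)]
    refine sup_le ?_ ?_
    · rintro _ ⟨t, rfl⟩
      induction t with
      | zero => simp
      | add s t hs ht => rw [map_add]; exact add_mem hs ht
      | tmul a b => exact Submodule.subset_span ⟨a, b, .inr b.2, rfl⟩
    · rintro _ ⟨t, rfl⟩
      induction t with
      | zero => simp
      | add s t hs ht => rw [map_add]; exact add_mem hs ht
      | tmul a b => exact Submodule.subset_span ⟨a, b, .inl a.2, rfl⟩
  · rw [Submodule.span_le]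
    rintro _ ⟨a, b, h | h, rfl⟩
    · simp [toFibre_eq_zero_iff.mpr h]
    · simp [toFibre_eq_zero_iff.mpr h]

lemma isInvolutiveIdeal_ker_map_toFibre (x : X) :
    IsInvolutiveIdeal (LinearMap.ker (TensorProduct.map (toFibre A x) (toFibre B x))) := by
  rw [ker_map_toFibre]
  refine ⟨fun s t ht => ?_, fun s t hs => ?_, fun s hs => ?_⟩
  · induction ht using Submodule.span_induction with
    | zero => simp
    | add u v _ _ hu hv => rw [mul_add]; exact add_mem hu hv
    | smul c u _ hu => rw [mul_smul_comm]; exact Submodule.smul_mem _ _ hu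
    | mem u hu =>
      obtain ⟨a, b, h, rfl⟩ := hu
      induction s with
      | zero => simp
      | add s t hs ht => rw [add_mul]; exact add_mem hs ht
      | tmul a' b' =>
        exact Submodule.subset_span ⟨a' * a, b' * b,
          h.imp (mul_mem_fibreIdeal_left a') (mul_mem_fibreIdeal_left b'),
          Algebra.TensorProduct.tmul_mul_tmul _ _ _ _⟩
  · induction hs using Submodule.span_induction with
    | zero => simp
    | add u v _ _ hu hv => rw [add_mul]; exact add_mem hu hv
    | smul c u _ hu => rw [smul_mul_assoc]; exact Submodule.smul_mem _ _ hu
    | mem u hu =>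
      obtain ⟨a, b, h, rfl⟩ := hu
      induction t with
      | zero => simp
      | add s t hs ht => rw [mul_add]; exact add_mem hs ht
      | tmul a' b' =>
        exact Submodule.subset_span ⟨a * a', b * b',
          h.imp (mul_mem_fibreIdeal_right a') (mul_mem_fibreIdeal_right b'),
          Algebra.TensorProduct.tmul_mul_tmul _ _ _ _⟩
  · induction hs using Submodule.span_induction with
    | zero => simp
    | add u v _ _ hu hv => rw [star_add]; exact add_mem hu hv
    | smul c u _ hu => rw [star_smul]; exact Submodule.smul_mem _ _ hu
    | mem u hu =>
      obtain ⟨a, b, h, rfl⟩ := hu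
      exact Submodule.subset_span ⟨star a, star b, h.imp star_mem_fibreIdeal star_mem_fibreIdeal,
        TensorProduct.star_tmul _ _⟩

lemma idealI_le_idealJ : idealI X A B ≤ idealJ X A B := by
  refine le_iInf fun x => sInf_le ⟨isInvolutiveIdeal_ker_map_toFibre x, fun f a b => ?_⟩
  rw [LinearMap.mem_ker, map_sub, TensorProduct.map_tmul, TensorProduct.map_tmul, toFibre_act,
    toFibre_act, TensorProduct.smul_tmul, sub_self]

lemma act_tmul_sub_tmul_act_mem_idealI (f : C(X, ℂ)) (a : A) (b : B) :
    act f a ⊗ₜ[ℂ] b - a ⊗ₜ[ℂ] act f b ∈ idealI X A B :=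
  (Submodule.mem_sInf).mpr fun _ hS => hS.2 f a b

/-- The image of `M ⊗ B` in `A ⊗ B` for a subspace `M` of `A`. -/
def leftRange (B : Type*) [NonUnitalCStarAlgebra B] (M : Submodule ℂ A) : Submodule ℂ (A ⊗[ℂ] B) :=
  LinearMap.range (LinearMap.rTensor B M.subtype)

omit [CXAlgebra X A] in
lemma tmul_mem_leftRange {M : Submodule ℂ A} {a : A} (ha : a ∈ M) (b : B) :
    a ⊗ₜ[ℂ] b ∈ leftRange B M :=
  ⟨(⟨a, ha⟩ : M) ⊗ₜ b, rfl⟩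

variable [CompactSpace X] [T2Space X]

lemma leftRange_inf_ker_le {M : Submodule ℂ A} (hM : ∀ (f : C(X, ℂ)), ∀ a ∈ M, act f a ∈ M)
    (x : X) :
    leftRange B M ⊓ LinearMap.ker (TensorProduct.map (toFibre A x) (toFibre B x)) ≤
      leftRange B (M ⊓ fibreIdeal A x) ⊔ idealI X A B := by
  rintro _ ⟨⟨γ, rfl⟩, hγ⟩
  set q : M →ₗ[ℂ] Fibre A x := toFibre A x ∘ₗ M.subtype with hq
  have hγ' : γ ∈ LinearMap.ker (TensorProduct.map q.rangeRestrict (toFibre B x)) := by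
    -- Flatness replaces A_x by the image of M, so right exactness applies to M itself and the new
    -- left factors stay in M.
    have hinj : Function.Injective (LinearMap.rTensor (Fibre B x) (LinearMap.range q).subtype) :=
      Module.Flat.rTensor_preserves_injective_linearMap _ (Submodule.injective_subtype _)
    rw [LinearMap.mem_ker]
    apply hinj
    rw [map_zero, ← LinearMap.mem_ker.mp hγ, LinearMap.rTensor, LinearMap.rTensor,
      ← LinearMap.comp_apply, ← LinearMap.comp_apply, ← TensorProduct.map_comp,
      ← TensorProduct.map_comp]
    rfl
  rw [TensorProduct.map_ker (f := (LinearMap.ker q).subtype) (f' := (fibreIdeal B x).subtype)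
    (LinearMap.exact_iff.mpr (by rw [LinearMap.ker_rangeRestrict, Submodule.range_subtype]))
    q.surjective_rangeRestrict
    (LinearMap.exact_iff.mpr (by rw [ker_toFibre, Submodule.range_subtype]))
    (toFibre_surjective x)] at hγ'
  obtain ⟨_, ⟨s, rfl⟩, _, ⟨t, rfl⟩, rfl⟩ := Submodule.mem_sup.mp hγ'
  clear hγ hγ'
  rw [map_add]
  refine add_mem ?_ ?_
  · induction s with
    | zero => simp
    | add s t hs ht => rw [map_add, map_add]; exact add_mem hs ht
    | tmul m b =>
      obtain ⟨g, c, hg, hc⟩ := exists_eq_act_of_mem_fibreIdeal b.2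
      have e : (m : A) ⊗ₜ[ℂ] (b : B) =
          act g (m : A) ⊗ₜ c - (act g (m : A) ⊗ₜ c - (m : A) ⊗ₜ act g c) := by
        rw [hc, sub_sub_cancel]
      simp only [LinearMap.lTensor_tmul, LinearMap.rTensor_tmul, Submodule.subtype_apply]
      rw [e]
      exact sub_mem (Submodule.mem_sup_left (tmul_mem_leftRange
        (Submodule.mem_inf.mpr ⟨hM g m m.2, act_mem_fibreIdeal hg _⟩) c))
        (Submodule.mem_sup_right (act_tmul_sub_tmul_act_mem_idealI g _ c))
  · induction t with
    | zero => simp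
    | add s t hs ht => rw [map_add, map_add]; exact add_mem hs ht
    | tmul m b =>
      refine Submodule.mem_sup_left (tmul_mem_leftRange (Submodule.mem_inf.mpr ⟨m.1.2, ?_⟩) b)
      exact toFibre_eq_zero_iff.mp m.2

lemma idealJ_le_leftRange_sup (F : Finset X) :
    idealJ X A B ≤ leftRange B (⨅ x ∈ F, fibreIdeal A x) ⊔ idealI X A B := by
  classical
  induction F using Finset.induction_on with
  | empty =>
    rintro t -
    refine Submodule.mem_sup_left ?_
    induction t with
    | zero => exact zero_mem _
    | add s t hs ht => exact add_mem hs ht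
    | tmul a b => exact tmul_mem_leftRange (by simp) b
  | insert x F _ ih =>
    intro α hα
    obtain ⟨β, hβ, γ, hγ, rfl⟩ := Submodule.mem_sup.mp (ih hα)
    have hβJ : β ∈ idealJ X A B := by
      simpa using sub_mem hα (idealI_le_idealJ hγ)
    refine add_mem ?_ (Submodule.mem_sup_right hγ)
    have := leftRange_inf_ker_le (B := B) (M := ⨅ x ∈ F, fibreIdeal A x) (fun f a ha => by
      simp only [Submodule.mem_iInf] at ha ⊢
      exact fun y hy => act_mem_fibreIdeal_of_mem f (ha y hy)) x
      ⟨hβ, (Submodule.mem_iInf _).mp hβJ x⟩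
    rwa [Finset.iInf_insert, inf_comm]

lemma sum_tmul_mem_idealI {ι : Type*} [Fintype ι] (a : ι → A) (b : ι → B)
    (ha : ∀ u : ι → ℂ, Continuous fun x : X => ‖toFibre A x (∑ i, u i • a i)‖)
    (hJ : ∑ i, a i ⊗ₜ[ℂ] b i ∈ idealJ X A B) : ∑ i, a i ⊗ₜ[ℂ] b i ∈ idealI X A B := by
  classical
  obtain ⟨T, a', hT, hker⟩ := exists_factorization a ha
  have hb (j : ι) : ∑ i, act (T i j) (b i) = 0 := by
    refine eq_zero_of_forall_toFibre_eq_zero (X := X) fun x => ?_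
    obtain ⟨φ, hφ⟩ := LinearMap.exists_eq_comp_of_ker_le
      (Fintype.linearCombination ℂ fun i => toFibre A x (a i))
      (Fintype.linearCombination ℂ fun i => T i j x) fun κ hκ => by
        simpa [Fintype.linearCombination_apply] using
          hker x κ (by simpa [Fintype.linearCombination_apply] using hκ) j
    have hφ' (i : ι) : φ (toFibre A x (a i)) = T i j x := by
      have := hφ (Pi.single i 1)
      simpa [Fintype.linearCombination_apply_single] using this.symm
    have h := (Submodule.mem_iInf _).mp hJ x
    have h' := congrArg ((TensorProduct.lid ℂ (Fibre B x)).toLinearMap ∘ₗ LinearMap.rTensor (Fibre B x) φ)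
      (LinearMap.mem_ker.mp h)
    simpa [hφ', toFibre_act] using h'
  have e : ∑ i, a i ⊗ₜ[ℂ] b i =
      ∑ i, ∑ j, (act (T i j) (a' j) ⊗ₜ[ℂ] b i - a' j ⊗ₜ[ℂ] act (T i j) (b i)) := by
    simp only [Finset.sum_sub_distrib, ← TensorProduct.sum_tmul, ← hT]
    rw [Finset.sum_comm]
    simp only [← TensorProduct.tmul_sum, hb, TensorProduct.tmul_zero, Finset.sum_const_zero,
      sub_zero]
  rw [e]
  exact sum_mem fun i _ => sum_mem fun j _ => act_tmul_sub_tmul_act_mem_idealI _ _ _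

/-- At points of F the norm is zero, where upper semicontinuity already gives continuity. -/
lemma continuous_norm_toFibre {F : Set X} (hF : F.Finite) {a : A}
    (ha : ContinuousOn (fun x : X => ‖toFibre A x a‖) Fᶜ) (haF : ∀ x ∈ F, a ∈ fibreIdeal A x) :
    Continuous fun x : X => ‖toFibre A x a‖ := by
  refine continuous_iff_continuousAt.mpr fun x => ?_
  by_cases hx : x ∈ F
  · have h0 : ‖toFibre A x a‖ = 0 := by rw [toFibre_eq_zero_iff.mpr (haF x hx), norm_zero]
    refine Metric.tendsto_nhds.mpr fun ε hε => ?_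
    filter_upwards [eventually_norm_toFibre_lt (h0.trans_lt hε)] with y hy
    simpa [h0] using hy
  · exact ha.continuousAt (hF.isClosed.isOpen_compl.mem_nhds hx)

theorem idealI_eq_idealJ (h : ∃ F : Set X, F.Finite ∧
    ∀ a : A, ContinuousOn (fun x : X => ‖toFibre A x a‖) Fᶜ) : idealI X A B = idealJ X A B := by
  obtain ⟨F, hF, hcont⟩ := h
  refine le_antisymm idealI_le_idealJ fun α hα => ?_
  obtain ⟨_, ⟨t, rfl⟩, γ, hγ, rfl⟩ := Submodule.mem_sup.mp (idealJ_le_leftRange_sup hF.toFinset hα)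
  refine add_mem ?_ hγ
  have hJ := sub_mem hα (idealI_le_idealJ hγ)
  rw [add_sub_cancel_right] at hJ
  obtain ⟨s, rfl⟩ := TensorProduct.exists_finset t
  simp only [map_sum, LinearMap.rTensor_tmul, Submodule.subtype_apply] at hJ ⊢
  rw [← Finset.sum_coe_sort] at hJ ⊢
  refine sum_tmul_mem_idealI _ _ (fun u => ?_) hJ
  refine continuous_norm_toFibre hF (hcont _) fun x hx => sum_mem fun i _ => Submodule.smul_mem _ _ ?_
  have := i.1.1.2
  simp only [Submodule.mem_iInf] at this
  exact this x (hF.mem_toFinset.mpr hx)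

end Tensor

end CXAlgebra

end

theorem mainTheorem6 :
    (∀ (X : Type*) (A : Type*) (B : Type*) [TopologicalSpace X] [CompactSpace X] [T2Space X]
        [NonUnitalCStarAlgebra A] [NonUnitalCStarAlgebra B] [CXAlgebra X A] [CXAlgebra X B],
        (∃ F : Set X, F.Finite ∧
          ∀ a : A, ContinuousOn (fun x : X => ‖CXAlgebra.toFibre A x a‖) Fᶜ) →
        CXAlgebra.idealI X A B = CXAlgebra.idealJ X A B) ∧
    (∀ (A : Type*) (B : Type*) [NonUnitalCStarAlgebra A] [NonUnitalCStarAlgebra B]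
        [CXAlgebra (OnePoint ℕ) A] [CXAlgebra (OnePoint ℕ) B],
        CXAlgebra.idealI (OnePoint ℕ) A B = CXAlgebra.idealJ (OnePoint ℕ) A B) := by
  refine ⟨fun X A B => CXAlgebra.idealI_eq_idealJ, fun A B => ?_⟩
  intros
  -- Every point other than ∞ is isolated, so continuity there is automatic.
  refine CXAlgebra.idealI_eq_idealJ ⟨{OnePoint.infty}, Set.finite_singleton _, fun a x hx => ?_⟩
  obtain ⟨n, rfl⟩ := OnePoint.ne_infty_iff_exists.mp hx
  refine ContinuousAt.continuousWithinAt ?_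
  rw [ContinuousAt, OnePoint.nhds_coe_eq, nhds_discrete, Filter.map_pure]
  exact tendsto_pure_nhds _ _
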